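/- Let $\rho>0$. There exists a constant $C>0$, depending only on $\rho$, such that the following holds for every bounded polygonal domain $P\subset\mathbb{R}^2$ (the domain enclosed by a simple closed polygon) with $N\ge 3$ vertices $z_1,\dots,z_N$, enumerated consecutively along $\partial P$ (interior angles equal to $\pi$ are allowed), edges $E(j)=\mathrm{conv}\{z_j,z_{j+1}\}$ ($z_{N+1}:=z_1$) and diameter $h_P$, which satisfies the mesh regularity condition (M2) $P$ is star-shaped with respect to every point of some ball of radius at least $\rho h_P$, and every edge $E(j)$ has length at least $\rho h_P$. (a) If $f\in H^1(P)$ and $0\in\mathrm{conv}\big\{\int_{E(1)}f\,ds,\dots,\int_{E(N)}f\,ds\big\}$, then $$\|f\|_{L^2(P)}\le C\,h_P\,|f|_{1,P}.$$ (b) If $f\in H^2(P)$, $0\in\mathrm{conv}\{f(z_1),\dots,f(z_N)\}$ and $0\in\mathrm{conv}\big\{\int_{E(1)}\frac{\partial f}{\partial x_i}\,ds,\dots,\int_{E(N)}\frac{\partial f}{\partial x_i}\,ds\big\}$ for $i=1$ and $i=2$, then $$\sum_{m=0}^{1}h_P^{m-2}|f|_{m,P}=h_P^{-2}\|f\|_{L^2(P)}+h_P^{-1}|f|_{1,P}\le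 C\,|f|_{2,P}.$$ Here $|f|_{0,P}=\|f\|_{L^2(P)}$, $|f|_{1,P}=\|\nabla f\|_{L^2(P)}$ and $|f|_{2,P}=\|D^2f\|_{L^2(P)}$ (Frobenius norm of the Hessian) are formed with weak derivatives, edge integrals are integrals of the trace on $\partial P$ with respect to arc length, and the values at vertices are those of the continuous representative of $f$ on $\overline P$. -/

import Mathlib

open MeasureTheory Set Filter Topology
open scoped ContDiff ENNReal

namespace PolygonPF

noncomputable section

/-- The Euclidean plane `ℝ²`. -/
abbrev Plane : Type := EuclideanSpace ℝ (Fin 2)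

/-! ### Polygonal domains and mesh regularity -/

/-- `P` is the (open) polygonal domain bounded by the simple closed polygon `p` with vertices
`p 0, …, p (N - 1)` and edges `E(j) = conv {p j, p (j + 1)}` (indices modulo `N`). Consecutive
edges may be collinear, i.e. an interior angle may be equal to `π`. -/
structure IsPolygonalDomain {N : ℕ} (p : Polygon Plane N) (P : Set Plane) : Prop where
  three_le : 3 ≤ N
  nondegenerate : p.HasNondegenerateEdges
  adjacent : ∀ j, p.edgeSet ℝ j ∩ p.edgeSet ℝ (finRotate N j) = {p (finRotate N j)}
  nonadjacent : ∀ j k, j ≠ k → k ≠ finRotate N j → j ≠ finRotate N k →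
    Disjoint (p.edgeSet ℝ j) (p.edgeSet ℝ k)
  isOpen : IsOpen P
  isConnected : IsConnected P
  isBounded : Bornology.IsBounded P
  frontier_eq : frontier P = p.boundary ℝ

/-- Mesh regularity with parameter `ρ`: the domain `P` of diameter `h_P` is star-shaped with
respect to every point of some ball of radius at least `ρ h_P`, and every edge has length at
least `ρ h_P`. -/
structure MeshRegular (ρ : ℝ) {N : ℕ} (p : Polygon Plane N) (P : Set Plane) : Prop where
  starShaped : ∃ (c : Plane) (r : ℝ), ρ * Metric.diam P ≤ r ∧
    ∀ y ∈ Metric.ball c r, StarConvex ℝ y P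
  edge_length : ∀ j, ρ * Metric.diam P ≤ dist (p j) (p (finRotate N j))

/-! ### Sobolev spaces on an open set of the plane -/

/-- The `i`-th classical partial derivative. -/
def partialDeriv (i : Fin 2) (φ : Plane → ℝ) (x : Plane) : ℝ :=
  fderiv ℝ φ x (EuclideanSpace.single i 1)

/-- The function `g ∈ L²(P)` is the `i`-th weak partial derivative of `f` on `P`. -/
def IsWeakPartial (P : Set Plane) (i : Fin 2) (f g : Plane → ℝ) : Prop :=
  MemLp g 2 (volume.restrict P) ∧
    ∀ φ : Plane → ℝ, ContDiff ℝ ∞ φ → HasCompactSupport φ → tsupport φ ⊆ P →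
      ∫ x in P, f x * partialDeriv i φ x = - ∫ x in P, g x * φ x

open Classical in
/-- The `i`-th weak partial derivative `∂f/∂x_i` on `P` (unique up to null sets; it is `0` by
convention if `f` has no weak partial derivative in `L²(P)`). -/
def weakPartial (P : Set Plane) (i : Fin 2) (f : Plane → ℝ) : Plane → ℝ :=
  if h : ∃ g, IsWeakPartial P i f g then h.choose else 0

/-- `f ∈ H¹(P)`. -/
def MemH1 (P : Set Plane) (f : Plane → ℝ) : Prop :=
  MemLp f 2 (volume.restrict P) ∧ ∀ i, ∃ g, IsWeakPartial P i f g

/-- `f ∈ H²(P)`. -/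
def MemH2 (P : Set Plane) (f : Plane → ℝ) : Prop :=
  MemH1 P f ∧ ∀ i, MemH1 P (weakPartial P i f)

/-- The norm `‖f‖_{L²(P)}`. -/
def l2Norm (P : Set Plane) (f : Plane → ℝ) : ℝ :=
  (eLpNorm f 2 (volume.restrict P)).toReal

/-- The seminorm `|f|_{1,P} = ‖∇f‖_{L²(P)}`. -/
def h1Seminorm (P : Set Plane) (f : Plane → ℝ) : ℝ :=
  √(∑ i, l2Norm P (weakPartial P i f) ^ 2)

/-- The seminorm `|f|_{2,P} = ‖D²f‖_{L²(P)}` (Frobenius norm of the Hessian). -/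
def h2Seminorm (P : Set Plane) (f : Plane → ℝ) : ℝ :=
  √(∑ i, ∑ k, l2Norm P (weakPartial P k (weakPartial P i f)) ^ 2)

/-! ### Boundary values -/

/-- The function `g ∈ L²(∂P)` is the trace of `f ∈ H¹(P)`: there are functions `φ n`, smooth up
to the boundary, with `φ n → f` in `H¹(P)` and `φ n → g` in `L²(∂P)`, where `∂P` carries the
arc length `ds`, i.e. the one-dimensional Hausdorff measure. -/
def IsTrace (P : Set Plane) (f g : Plane → ℝ) : Prop :=
  MemLp g 2 ((Measure.hausdorffMeasure 1).restrict (frontier P)) ∧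
  ∃ φ : ℕ → Plane → ℝ, (∀ n, ContDiff ℝ ∞ (φ n)) ∧
    Tendsto (fun n => eLpNorm (φ n - f) 2 (volume.restrict P)) atTop (𝓝 0) ∧
    (∀ i, Tendsto (fun n => eLpNorm (partialDeriv i (φ n) - weakPartial P i f) 2
      (volume.restrict P)) atTop (𝓝 0)) ∧
    Tendsto (fun n => eLpNorm (φ n - g) 2
      ((Measure.hausdorffMeasure 1).restrict (frontier P))) atTop (𝓝 0)

open Classical in
/-- The trace of `f` on `∂P`, as a function on the plane of which only the values on `∂P` matter
(`0` by convention if `f` has no trace). -/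
def trace (P : Set Plane) (f : Plane → ℝ) : Plane → ℝ :=
  if h : ∃ g, IsTrace P f g then h.choose else 0

/-- The integral `∫_{E(j)} f ds` of the trace of `f` over the `j`-th edge. -/
def edgeIntegral {N : ℕ} (p : Polygon Plane N) (P : Set Plane) (f : Plane → ℝ) (j : Fin N) : ℝ :=
  ∫ x in p.edgeSet ℝ j, trace P f x ∂(Measure.hausdorffMeasure 1)

/-- `F` is continuous on the closure of `P` and agrees with `f` almost everywhere in `P`. -/
def IsContinuousRep (P : Set Plane) (f F : Plane → ℝ) : Prop :=
  ContinuousOn F (closure P) ∧ F =ᵐ[volume.restrict P] f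

open Classical in
/-- The continuous representative of `f ∈ H²(P) ⊂ C(closure P)`; only its values on the closure
of `P` matter (`0` by convention if there is no continuous representative). -/
def continuousRep (P : Set Plane) (f : Plane → ℝ) : Plane → ℝ :=
  if h : ∃ F, IsContinuousRep P f F then h.choose else 0

/-- The point value `f(z_j)` of `f ∈ H²(P)` at the `j`-th vertex. -/
def vertexValue {N : ℕ} (p : Polygon Plane N) (P : Set Plane) (f : Plane → ℝ) (j : Fin N) : ℝ :=
  continuousRep P f (p j)

end

end PolygonPF

namespace PolygonPF

/-! Let h be the diameter of P, and let m be the average of f over B, the concentric ball with half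
the radius of the ball in the star-shapedness condition. Segments from points of the closure of P to
points of B stay in P. Integrating along them and averaging over B bounds f - m by h|f|₁ in L²(P),
by |f|₁ in quadratic mean along each edge, and by |f|₁ + h|f|₂ uniformly on the closure. The last
bound uses a Taylor formula based at the points of B. For smooth functions these estimates are
`exists_const_sub_average`; they are explicit changes of variables, so the constants depend on ρ
alone.

A vanishing convex combination controls m. If Σ w_j ∫_{E(j)} f = 0, then L m = -Σ w_j ∫_{E(j)} (f -
m) with L = Σ w_j |E(j)| ≥ ρh, which bounds |m| by the edge estimate. If Σ w_j f(z_j) = 0, then |m|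
is at most the maximum of |f - m|. `exists_const_smooth` keeps the combination as an error term,
because smooth approximants of f need not satisfy the constraint. Part (b) follows by applying (a)
to the partial derivatives, which gives |f|₁ ≤ Ch|f|₂, and then the uniform bound to f.

The passage to Sobolev functions is `exists_smooth_approx`: averaging over short pieces of rays
towards the ball uses only values in P, yet produces functions smooth on the whole plane. The
estimates above, applied to differences of approximants, also show that traces and continuous
representatives exist (`exists_isTrace`, `tendsto_continuousRep`). Hence the default values in the
definitions of `trace` and `continuousRep` do not occur, and edge integrals and vertex values are
limits of those of the approximants. -/

/-! ### Cauchy–Schwarz and linear changes of variables -/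

theorem sq_lintegral_le {α : Type*} [MeasurableSpace α] (ν : Measure α) {g : α → ℝ≥0∞}
    (hg : AEMeasurable g ν) : (∫⁻ x, g x ∂ν) ^ 2 ≤ ν univ * ∫⁻ x, g x ^ 2 ∂ν := by
  have h := ENNReal.lintegral_mul_le_Lp_mul_Lq ν Real.HolderConjugate.two_two
    (f := fun _ => 1) (g := g) aemeasurable_const hg
  simp only [Pi.mul_apply, one_mul, ENNReal.one_rpow, lintegral_const] at h
  have h2 := pow_le_pow_left' h 2
  rw [mul_pow, ← ENNReal.rpow_natCast, ← ENNReal.rpow_natCast _ 2, ← ENNReal.rpow_mul,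
    ← ENNReal.rpow_natCast _ 2, ← ENNReal.rpow_mul] at h2
  simpa using h2

theorem lintegral_comp_affine {G : Plane → ℝ≥0∞} (hG : Measurable G) (w : Plane) {t : ℝ}
    (ht : t ≠ 0) :
    ∫⁻ x, G (w + t • x) = ENNReal.ofReal (t ^ 2)⁻¹ * ∫⁻ z, G z := by
  have h1 : ∫⁻ x, G (w + t • x) = ∫⁻ x, G (w + x) ∂(Measure.map (t • ·) volume) := by
    rw [lintegral_map (by fun_prop) (by fun_prop)]
  rw [h1, Measure.map_addHaar_smul _ ht, lintegral_smul_measure, lintegral_add_left_eq_self]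
  simp [abs_inv]

theorem setLIntegral_comp_affine_le {G : Plane → ℝ≥0∞} (hG : Measurable G) (w : Plane) {t : ℝ}
    (ht : t ≠ 0) {S Q : Set Plane} (hS : MeasurableSet S) (hQ : MeasurableSet Q)
    (h : ∀ x ∈ S, w + t • x ∈ Q) :
    ∫⁻ x in S, G (w + t • x) ≤ ENNReal.ofReal (t ^ 2)⁻¹ * ∫⁻ z in Q, G z := by
  rw [← lintegral_indicator hQ, ← lintegral_comp_affine (hG.indicator hQ) w ht]
  refine le_trans (le_of_eq (setLIntegral_congr_fun hS fun x hx => ?_)) (setLIntegral_le_lintegral S _)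
  simp [indicator_of_mem (h x hx)]

/-- The cross product of two vectors of the plane. -/
def cross (u v : Plane) : ℝ := u 0 * v 1 - u 1 * v 0

/-- The linear map with columns u and v has determinant `cross u v`. This turns a double integral
over an edge parameter and a ray parameter into an area integral. -/
theorem lintegral_comp_parallelogram {G : Plane → ℝ≥0∞} (hG : Measurable G) (a u v : Plane)
    (h : cross u v ≠ 0) :
    ∫⁻ t : ℝ, ∫⁻ s : ℝ, G (a + t • u + s • v) = ENNReal.ofReal |cross u v|⁻¹ * ∫⁻ z, G z := by
  let A : Matrix (Fin 2) (Fin 2) ℝ := !![u 0, v 0; u 1, v 1]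
  have hA : A.det = cross u v := by
    rw [Matrix.det_fin_two_of, cross]; ring
  let L : Plane →ₗ[ℝ] Plane := Matrix.toLpLin 2 2 A
  have hL : LinearMap.det L = cross u v := by
    rw [← hA, LinearMap.det_toLpLin]
  have e1 : ∫⁻ x : Plane, G (a + L x) = ENNReal.ofReal |cross u v|⁻¹ * ∫⁻ z, G z := by
    have h1 : ∫⁻ x, G (a + L x) = ∫⁻ x, G (a + x) ∂(Measure.map L volume) := by
      rw [lintegral_map (by fun_prop) (LinearMap.continuous_of_finiteDimensional L).measurable]
    rw [h1, Measure.map_linearMap_addHaar_eq_smul_addHaar _ (by rw [hL]; exact h), hL,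
      lintegral_smul_measure, lintegral_add_left_eq_self]
    simp [abs_inv]
  rw [← e1, ← (PiLp.volume_preserving_toLp (Fin 2)).lintegral_comp (by
      have := (LinearMap.continuous_of_finiteDimensional L).measurable; fun_prop),
    ← ((volume_preserving_finTwoArrow ℝ).symm).lintegral_comp (by
      have := (LinearMap.continuous_of_finiteDimensional L).measurable; fun_prop),
    Measure.volume_eq_prod, lintegral_prod _ (by
      have := (LinearMap.continuous_of_finiteDimensional L).measurable; fun_prop)]
  refine lintegral_congr fun t => lintegral_congr fun s => ?_
  rw [add_assoc]
  congr 2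
  ext i
  fin_cases i <;> simp [L, A, Matrix.toLpLin_apply]

/-! ### Taylor estimates along a segment -/

theorem enorm_sub_sq_le_lintegral {g g' : ℝ → ℝ} (hg : ∀ t, HasDerivAt g (g' t) t)
    (hg' : Continuous g') : ‖g 1 - g 0‖ₑ ^ 2 ≤ ∫⁻ t in Ioo (0 : ℝ) 1, ‖g' t‖ₑ ^ 2 := by
  rw [← intervalIntegral.integral_eq_sub_of_hasDerivAt (fun t _ => hg t)
    (hg'.intervalIntegrable 0 1), intervalIntegral.integral_of_le zero_le_one,
    restrict_Ioo_eq_restrict_Ioc]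
  refine (pow_le_pow_left' (enorm_integral_le_lintegral_enorm _) 2).trans ?_
  refine (sq_lintegral_le _ (by fun_prop)).trans ?_
  simp

/-- The squared length of the gradient. -/
noncomputable def gradSq (φ : Plane → ℝ) (z : Plane) : ℝ≥0∞ := ∑ i, ‖partialDeriv i φ z‖ₑ ^ 2

/-- The squared Frobenius norm of the Hessian. -/
noncomputable def hessSq (φ : Plane → ℝ) (z : Plane) : ℝ≥0∞ :=
  ∑ i, ∑ k, ‖partialDeriv k (partialDeriv i φ) z‖ₑ ^ 2

theorem contDiff_partialDeriv {φ : Plane → ℝ} (hφ : ContDiff ℝ ∞ φ) (i : Fin 2) :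
    ContDiff ℝ ∞ (partialDeriv i φ) := by
  have h : ContDiff ℝ ∞ (fderiv ℝ φ) := hφ.fderiv_right (by simp)
  exact h.clm_apply contDiff_const

theorem measurable_gradSq {φ : Plane → ℝ} (hφ : ContDiff ℝ ∞ φ) : Measurable (gradSq φ) := by
  have h := fun i => (contDiff_partialDeriv hφ i).continuous.measurable
  unfold gradSq
  fun_prop

theorem measurable_hessSq {φ : Plane → ℝ} (hφ : ContDiff ℝ ∞ φ) : Measurable (hessSq φ) := by
  have h := fun i k => (contDiff_partialDeriv (contDiff_partialDeriv hφ i) k).continuous.measurable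
  unfold hessSq
  fun_prop

theorem fderiv_apply_eq (φ : Plane → ℝ) (z v : Plane) :
    fderiv ℝ φ z v = ∑ i, v i * partialDeriv i φ z := by
  have hv : v = ∑ i, v i • EuclideanSpace.single i (1 : ℝ) := by
    ext j
    fin_cases j <;> simp [Fin.sum_univ_two]
  conv_lhs => rw [hv]
  simp [partialDeriv]

theorem hasDerivAt_comp_ray {φ : Plane → ℝ} (hφ : ContDiff ℝ ∞ φ) (x v : Plane) (t : ℝ) :
    HasDerivAt (fun t : ℝ => φ (x + t • v)) (∑ i, v i * partialDeriv i φ (x + t • v)) t := by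
  rw [← fderiv_apply_eq]
  have h1 : HasDerivAt (fun t : ℝ => x + t • v) v t := by
    simpa using ((hasDerivAt_id t).smul_const v).const_add x
  exact ((hφ.differentiable (by simp)) _).hasFDerivAt.comp_hasDerivAt t h1

theorem enorm_sum_mul_sq_le (v : Plane) (w : Fin 2 → ℝ) :
    ‖∑ i, v i * w i‖ₑ ^ 2 ≤ ‖v‖ₑ ^ 2 * ∑ i, ‖w i‖ₑ ^ 2 := by
  have h : (∑ i, v i * w i) ^ 2 ≤ ‖v‖ ^ 2 * ∑ i, (w i) ^ 2 := by
    rw [EuclideanSpace.norm_sq_eq]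
    simpa using Finset.sum_mul_sq_le_sq_mul_sq Finset.univ (fun i => v i) w
  have e : ∀ a : ℝ, ‖a‖ₑ ^ 2 = ENNReal.ofReal (a ^ 2) := fun a => by
    rw [← sq_abs, ENNReal.ofReal_pow (abs_nonneg a), Real.enorm_eq_ofReal_abs]
  simp_rw [e, ← ofReal_norm v]
  rw [← ENNReal.ofReal_pow (norm_nonneg v), ← ENNReal.ofReal_sum_of_nonneg (fun i _ => sq_nonneg _),
    ← ENNReal.ofReal_mul (by positivity)]
  exact ENNReal.ofReal_le_ofReal h

theorem enorm_sub_sq_le_ray {φ : Plane → ℝ} (hφ : ContDiff ℝ ∞ φ) (x y : Plane) :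
    ‖φ x - φ y‖ₑ ^ 2 ≤
      ‖y - x‖ₑ ^ 2 * ∫⁻ t in Ioo (0 : ℝ) 1, gradSq φ (x + t • (y - x)) := by
  have h := enorm_sub_sq_le_lintegral (fun t => hasDerivAt_comp_ray hφ x (y - x) t) (by
    have h := fun i => (contDiff_partialDeriv hφ i).continuous
    fun_prop)
  have e : ‖φ x - φ y‖ₑ = ‖φ (x + (1 : ℝ) • (y - x)) - φ (x + (0 : ℝ) • (y - x))‖ₑ := by
    rw [← enorm_neg]; simp
  rw [e, ← lintegral_const_mul _ (by have := measurable_gradSq hφ; fun_prop)]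
  exact h.trans (lintegral_mono fun t => enorm_sum_mul_sq_le _ _)

/-- With g the restriction of φ to the segment from x to y, the function t g'(t) - g(t) has
derivative t g''(t). Expanding at y rather than at x makes the weight t vanish at x, exactly where
the Jacobian t⁻² of averaging over y blows up. -/
theorem enorm_taylor_sq_le_ray {φ : Plane → ℝ} (hφ : ContDiff ℝ ∞ φ) (x y : Plane) :
    ‖φ x - φ y + ∑ i, (y - x) i * partialDeriv i φ y‖ₑ ^ 2 ≤
      ‖y - x‖ₑ ^ 4 * ∫⁻ t in Ioo (0 : ℝ) 1, ‖t‖ₑ ^ 2 * hessSq φ (x + t • (y - x)) := by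
  have hd : ∀ t : ℝ, HasDerivAt (fun t : ℝ =>
      t * (∑ i, (y - x) i * partialDeriv i φ (x + t • (y - x))) - φ (x + t • (y - x)))
      (t * ∑ i, (y - x) i * ∑ k, (y - x) k *
        partialDeriv k (partialDeriv i φ) (x + t • (y - x))) t := by
    intro t
    have h2 := HasDerivAt.fun_sum (u := Finset.univ) fun i _ =>
      (hasDerivAt_comp_ray (contDiff_partialDeriv hφ i) x (y - x) t).const_mul ((y - x) i)
    refine (((hasDerivAt_id' t).fun_mul h2).fun_sub
      (hasDerivAt_comp_ray hφ x (y - x) t)).congr_deriv ?_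
    ring
  have h := enorm_sub_sq_le_lintegral hd (by
    have h := fun i k => (contDiff_partialDeriv (contDiff_partialDeriv hφ i) k).continuous
    fun_prop)
  have e : φ x - φ y + ∑ i, (y - x) i * partialDeriv i φ y =
      (1 * (∑ i, (y - x) i * partialDeriv i φ (x + (1 : ℝ) • (y - x))) - φ (x + (1 : ℝ) • (y - x)))
      - (0 * (∑ i, (y - x) i * partialDeriv i φ (x + (0 : ℝ) • (y - x)))
        - φ (x + (0 : ℝ) • (y - x))) := by
    simp
    ring
  rw [e, ← lintegral_const_mul _ (by
    have := (measurable_hessSq hφ); fun_prop)]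
  refine h.trans (lintegral_mono fun t => ?_)
  rw [enorm_mul, mul_pow]
  calc _ ≤ ‖t‖ₑ ^ 2 * (‖y - x‖ₑ ^ 2 * ∑ i, (‖y - x‖ₑ ^ 2 * ∑ k,
        ‖partialDeriv k (partialDeriv i φ) (x + t • (y - x))‖ₑ ^ 2)) := by
        gcongr
        refine (enorm_sum_mul_sq_le _ _).trans ?_
        gcongr
        exact enorm_sum_mul_sq_le _ _
    _ = _ := by
        rw [hessSq, ← Finset.mul_sum]
        ring

/-! ### Averaging over rays in a star-shaped domain -/

/-- `P` is a bounded open set that is star-shaped with respect to every point of a ball. -/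
structure StarBall (P : Set Plane) (c : Plane) (r : ℝ) : Prop where
  isOpen : IsOpen P
  isBounded : Bornology.IsBounded P
  nonempty : P.Nonempty
  pos : 0 < r
  star : ∀ y ∈ Metric.ball c r, StarConvex ℝ y P

namespace StarBall

variable {P : Set Plane} {c : Plane} {r : ℝ} (h : StarBall P c r)
include h

theorem ball_subset : Metric.ball c r ⊆ P := fun _ hy => (h.star _ hy).mem h.nonempty

/-- Move x to a nearby point of P and compensate by moving y so that the given point of the segment
stays fixed. A small enough perturbation keeps the new y in the open ball, and star-shapedness
applies. -/
theorem mem_of_closure {x y : Plane} (hx : x ∈ closure P) (hy : y ∈ Metric.ball c r) {t : ℝ}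
    (ht0 : 0 < t) (ht1 : t ≤ 1) : x + t • (y - x) ∈ P := by
  have hcont : Tendsto (fun x' : Plane => y + (t⁻¹ * (1 - t)) • (x - x')) (𝓝 x) (𝓝 y) := by
    have : Continuous fun x' : Plane => y + (t⁻¹ * (1 - t)) • (x - x') := by fun_prop
    simpa using this.tendsto x
  obtain ⟨x', hx', hx'P⟩ := mem_closure_iff_nhds.1 hx _
    (hcont (Metric.isOpen_ball.mem_nhds hy))
  have := (h.star _ hx') hx'P ht0.le (sub_nonneg.2 ht1) (by ring)
  convert this using 1
  rw [smul_add, smul_smul, ← mul_assoc, mul_inv_cancel₀ ht0.ne']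
  module

theorem norm_sub_le {x y : Plane} (hx : x ∈ closure P) (hy : y ∈ closure P) :
    ‖y - x‖ ≤ Metric.diam P := by
  rw [← dist_eq_norm, ← Metric.diam_closure]
  exact Metric.dist_le_diam_of_mem h.isBounded.closure hy hx

theorem enorm_sub_le {x y : Plane} (hx : x ∈ closure P) (hy : y ∈ closure P) :
    ‖y - x‖ₑ ≤ ENNReal.ofReal (Metric.diam P) := by
  rw [← ofReal_norm]
  exact ENNReal.ofReal_le_ofReal (h.norm_sub_le hx hy)

theorem half_subset : Metric.ball c (r / 2) ⊆ Metric.ball c r :=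
  Metric.ball_subset_ball (by linarith [h.pos])

theorem half_subset_set : Metric.ball c (r / 2) ⊆ P := h.half_subset.trans h.ball_subset

theorem lintegral_half_ray_le {G : Plane → ℝ≥0∞} (hG : Measurable G) {x : Plane}
    (hx : x ∈ closure P) {t : ℝ} (ht0 : 0 < t) (ht1 : t ≤ 1) :
    ∫⁻ y in Metric.ball c (r / 2), G (x + t • (y - x)) ≤
      ENNReal.ofReal (t ^ 2)⁻¹ * ∫⁻ z in P, G z := by
  have e : ∀ y, x + t • (y - x) = (1 - t) • x + t • y := fun y => by module
  simp_rw [e]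
  refine setLIntegral_comp_affine_le hG _ ht0.ne' measurableSet_ball h.isOpen.measurableSet
    fun y hy => ?_
  rw [← e]
  exact h.mem_of_closure hx (h.half_subset hy) ht0 ht1

theorem lintegral_half_ray_le_four {G : Plane → ℝ≥0∞} (hG : Measurable G) {x : Plane}
    (hx : x ∈ closure P) {t : ℝ} (ht0 : 1 / 2 ≤ t) (ht1 : t ≤ 1) :
    ∫⁻ y in Metric.ball c (r / 2), G (x + t • (y - x)) ≤ 4 * ∫⁻ z in P, G z := by
  refine (h.lintegral_half_ray_le hG hx (by linarith) ht1).trans ?_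
  gcongr
  refine ENNReal.ofReal_le_of_le_toReal ?_
  rw [inv_le_comm₀ (by positivity) (by norm_num)]
  norm_num
  nlinarith

theorem lintegral_set_ray_le_four {G : Plane → ℝ≥0∞} (hG : Measurable G) {y : Plane}
    (hy : y ∈ Metric.ball c r) {t : ℝ} (ht0 : 0 < t) (ht1 : t ≤ 1 / 2) :
    ∫⁻ x in P, G (x + t • (y - x)) ≤ 4 * ∫⁻ z in P, G z := by
  have e : ∀ x, x + t • (y - x) = t • y + (1 - t) • x := fun y => by module
  simp_rw [e]
  refine (setLIntegral_comp_affine_le hG _ (by linarith) h.isOpen.measurableSet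
    h.isOpen.measurableSet fun x hx => ?_).trans ?_
  · rw [← e]
    exact h.mem_of_closure (subset_closure hx) hy ht0 (by linarith)
  gcongr
  refine ENNReal.ofReal_le_of_le_toReal ?_
  rw [inv_le_comm₀ (by nlinarith) (by norm_num)]
  norm_num
  nlinarith

/-- For each t the point (1 - t)x + ty depends on x with Jacobian (1 - t)² and on y with Jacobian
t². One of the two is at least 1/4, so integrating first in the corresponding variable costs at most
a factor 4. -/
theorem lintegral_lintegral_ray_le {G : Plane → ℝ≥0∞} (hG : Measurable G) :
    ∫⁻ x in P, ∫⁻ y in Metric.ball c (r / 2), ∫⁻ t in Ioo (0 : ℝ) 1, G (x + t • (y - x)) ≤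
      4 * (volume (Metric.ball c (r / 2)) + volume P) * ∫⁻ z in P, G z := by
  have e1 : ∀ x : Plane, ∫⁻ y in Metric.ball c (r / 2), ∫⁻ t in Ioo (0 : ℝ) 1,
      G (x + t • (y - x)) = ∫⁻ t in Ioo (0 : ℝ) 1, ∫⁻ y in Metric.ball c (r / 2),
      G (x + t • (y - x)) := fun x => by
    rw [lintegral_lintegral_swap]
    exact (by fun_prop : Measurable _).aemeasurable
  simp_rw [e1]
  rw [lintegral_lintegral_swap (by
    refine Measurable.aemeasurable ?_
    refine Measurable.lintegral_prod_right' (f := fun q : (Plane × ℝ) × Plane =>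
      G (q.1.1 + q.1.2 • (q.2 - q.1.1))) (by fun_prop))]
  have key : ∀ t ∈ Ioo (0 : ℝ) 1, ∫⁻ x in P, ∫⁻ y in Metric.ball c (r / 2),
      G (x + t • (y - x)) ≤ 4 * (volume (Metric.ball c (r / 2)) + volume P) * ∫⁻ z in P, G z := by
    intro t ht
    rcases le_total t (1 / 2) with h2 | h2
    · rw [lintegral_lintegral_swap (by
        exact (by fun_prop : Measurable _).aemeasurable)]
      refine (setLIntegral_mono' measurableSet_ball fun y hy =>
        h.lintegral_set_ray_le_four hG (h.half_subset hy) ht.1 h2).trans ?_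
      rw [setLIntegral_const, mul_right_comm]
      gcongr
      exact le_self_add
    · refine (setLIntegral_mono' h.isOpen.measurableSet fun x hx =>
        h.lintegral_half_ray_le_four hG (subset_closure hx) h2 ht.2.le).trans ?_
      rw [setLIntegral_const, mul_right_comm]
      gcongr
      exact le_add_self
  refine (setLIntegral_mono' measurableSet_Ioo key).trans ?_
  simp
end StarBall

/-! ### Rays starting on an edge -/

theorem sq_enorm_average_le {μ : Measure Plane} [IsFiniteMeasure μ] {f : Plane → ℝ}
    (hf : AEMeasurable f μ) : μ univ * ‖⨍ x, f x ∂μ‖ₑ ^ 2 ≤ ∫⁻ x, ‖f x‖ₑ ^ 2 ∂μ := by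
  rcases eq_or_ne (μ univ) 0 with h0 | h0
  · simp [h0]
  have ht : μ univ ≠ ⊤ := measure_ne_top _ _
  have h1 : ‖⨍ x, f x ∂μ‖ₑ ≤ (μ univ)⁻¹ * ∫⁻ x, ‖f x‖ₑ ∂μ := by
    refine (enorm_integral_le_lintegral_enorm _).trans_eq ?_
    rw [lintegral_smul_measure, smul_eq_mul]
  calc _ ≤ μ univ * ((μ univ)⁻¹ * ∫⁻ x, ‖f x‖ₑ ∂μ) ^ 2 := by gcongr
    _ ≤ μ univ * ((μ univ)⁻¹ ^ 2 * (μ univ * ∫⁻ x, ‖f x‖ₑ ^ 2 ∂μ)) := by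
        rw [mul_pow]
        gcongr
        exact sq_lintegral_le _ hf.enorm
    _ = (μ univ * (μ univ)⁻¹) ^ 2 * ∫⁻ x, ‖f x‖ₑ ^ 2 ∂μ := by ring
    _ = _ := by rw [ENNReal.mul_inv_cancel h0 ht]; simp

theorem enorm_add_sq_le (a b : ℝ) : ‖a + b‖ₑ ^ 2 ≤ 2 * ‖a‖ₑ ^ 2 + 2 * ‖b‖ₑ ^ 2 := by
  have e : ∀ a : ℝ, ‖a‖ₑ ^ 2 = ENNReal.ofReal (a ^ 2) := fun a => by
    rw [← sq_abs, ENNReal.ofReal_pow (abs_nonneg a), Real.enorm_eq_ofReal_abs]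
  have e2 : (2 : ℝ≥0∞) = ENNReal.ofReal 2 := by simp
  rw [e, e, e, e2, ← ENNReal.ofReal_mul (by norm_num), ← ENNReal.ofReal_mul (by norm_num),
    ← ENNReal.ofReal_add (by positivity) (by positivity)]
  exact ENNReal.ofReal_le_ofReal (by nlinarith [sq_nonneg (a - b)])

theorem lintegral_comp_mul_left_real {H : ℝ → ℝ≥0∞} (hH : Measurable H) {t : ℝ} (ht : 0 < t) :
    ∫⁻ s, H (t * s) = ENNReal.ofReal t⁻¹ * ∫⁻ s, H s := by
  have h1 : ∫⁻ s, H (t * s) = ∫⁻ s, H s ∂(Measure.map (t • ·) volume) := by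
    rw [lintegral_map hH (by fun_prop)]; rfl
  rw [h1, Measure.map_addHaar_smul _ ht.ne', lintegral_smul_measure]
  simp [abs_of_pos ht, abs_inv]

theorem edge_mem_closure {P : Set Plane} {a b : Plane} (hab : segment ℝ a b ⊆ frontier P) {s : ℝ}
    (hs : s ∈ Icc (0 : ℝ) 1) : a + s • (b - a) ∈ closure P := by
  refine frontier_subset_closure (hab ?_)
  rw [segment_eq_image']
  exact ⟨s, hs, rfl⟩

namespace StarBall

variable {P : Set Plane} {c : Plane} {r : ℝ} (h : StarBall P c r)
include h

theorem measure_half_ne_zero : volume (Metric.ball c (r / 2)) ≠ 0 :=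
  (Metric.measure_ball_pos _ _ (by linarith [h.pos])).ne'

theorem measure_ne_top : volume P ≠ ⊤ := h.isBounded.measure_lt_top.ne

/-- A point of the line in the ball either lies on the edge, which is disjoint from the open set P,
or lies beyond one endpoint. In the latter case that endpoint is on a segment from the other
endpoint to the ball, hence in P, a contradiction. -/
theorem line_notMem_ball {a b : Plane} (hab : segment ℝ a b ⊆ frontier P) (τ : ℝ) :
    a + τ • (b - a) ∉ Metric.ball c r := by
  intro hy
  have hd : ∀ z ∈ frontier P, z ∉ P := fun z hz hzP => by
    rw [h.isOpen.frontier_eq] at hz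
    exact hz.2 hzP
  have ha := hab (left_mem_segment ℝ a b)
  have hb := hab (right_mem_segment ℝ a b)
  rcases lt_or_ge τ 0 with h0 | h0
  · have := h.mem_of_closure (frontier_subset_closure hb) hy (t := (1 - τ)⁻¹)
      (inv_pos.2 (by linarith)) (inv_le_one_of_one_le₀ (by linarith))
    refine hd _ ha ?_
    convert this using 1
    rw [show a + τ • (b - a) - b = (1 - τ) • (a - b) by module, smul_smul,
      inv_mul_cancel₀ (by linarith)]
    module
  rcases lt_or_ge 1 τ with h1 | h1
  · have := h.mem_of_closure (frontier_subset_closure ha) hy (t := τ⁻¹)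
      (inv_pos.2 (by linarith)) (inv_le_one_of_one_le₀ h1.le)
    refine hd _ hb ?_
    convert this using 1
    rw [add_sub_cancel_left, smul_smul, inv_mul_cancel₀ (by linarith)]
    module
  · refine hd _ (hab ?_) (h.ball_subset hy)
    rw [segment_eq_image']
    exact ⟨τ, ⟨h0, h1⟩, rfl⟩

/-- The cross product is the edge length times the distance from y to the line of the edge. That
line misses the full ball, so it is at distance at least r / 2 from the half ball. This is why
averages are taken over the half ball. -/
theorem le_abs_cross {a b : Plane} (hab : segment ℝ a b ⊆ frontier P) (hne : a ≠ b) {y : Plane}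
    (hy : y ∈ Metric.ball c (r / 2)) : r / 2 * ‖b - a‖ ≤ |cross (y - a) (b - a)| := by
  by_contra! hlt
  set v := b - a with hv
  have hv0 : 0 < ‖v‖ := norm_pos_iff.2 (sub_ne_zero.2 hne.symm)
  set k := cross (y - a) v with hk
  have hsq : ‖v‖ ^ 2 = v 0 ^ 2 + v 1 ^ 2 := by
    rw [EuclideanSpace.norm_sq_eq, Fin.sum_univ_two]; simp
  have hsq0 : v 0 ^ 2 + v 1 ^ 2 ≠ 0 := by rw [← hsq]; positivity
  let w : Plane := !₂[v 1, -v 0]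
  have hw : ‖w‖ = ‖v‖ := by
    rw [← sq_eq_sq₀ (norm_nonneg _) (norm_nonneg _), hsq, EuclideanSpace.norm_sq_eq,
      Fin.sum_univ_two]
    simp [w]
    ring
  -- Both sides are the foot of the perpendicular from y; `w` is v turned by a right angle.
  have hq : y - (k / ‖v‖ ^ 2) • w =
      a + (((y - a) 0 * v 0 + (y - a) 1 * v 1) / ‖v‖ ^ 2) • v := by
    rw [hsq]
    ext i
    fin_cases i <;> simp [w, hk, cross] <;> field_simp <;> ring
  have hd : ‖(k / ‖v‖ ^ 2) • w‖ < r / 2 := by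
    rw [norm_smul, hw, norm_div, norm_pow, norm_norm, Real.norm_eq_abs, sq, ← div_div,
      div_mul_cancel₀ _ hv0.ne', div_lt_iff₀ hv0]
    exact hlt
  refine h.line_notMem_ball hab (((y - a) 0 * v 0 + (y - a) 1 * v 1) / ‖v‖ ^ 2) ?_
  rw [← hv, ← hq, Metric.mem_ball]
  rw [Metric.mem_ball] at hy
  calc dist (y - (k / ‖v‖ ^ 2) • w) c ≤ dist (y - (k / ‖v‖ ^ 2) • w) y + dist y c :=
        dist_triangle _ _ _
    _ < r / 2 + r / 2 := by
        refine add_lt_add ?_ hy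
        rw [dist_eq_norm, sub_sub_cancel_left, norm_neg]
        exact hd
    _ = r := by ring

/-- For fixed y the parameters (t, s) sweep the triangle over the edge with apex y, with Jacobian (1
- t) times the cross product. It is bounded below for t ≤ 1/2, where averaging over y would be
useless. -/
theorem lintegral_edge_near_le {G : Plane → ℝ≥0∞} (hG : Measurable G) {a b : Plane}
    (hab : segment ℝ a b ⊆ frontier P) (hne : a ≠ b) {y : Plane}
    (hy : y ∈ Metric.ball c (r / 2)) :
    ∫⁻ t in Ioc (0 : ℝ) (1 / 2), ∫⁻ s in Ioo (0 : ℝ) 1,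
        G ((a + s • (b - a)) + t • (y - (a + s • (b - a)))) ≤
      2 * ENNReal.ofReal (r / 2 * ‖b - a‖)⁻¹ * ∫⁻ z in P, G z := by
  have hc := h.le_abs_cross hab hne hy
  have hv0 : 0 < ‖b - a‖ := norm_pos_iff.2 (sub_ne_zero.2 hne.symm)
  have hr := h.pos
  have hc0 : 0 < r / 2 * ‖b - a‖ := by positivity
  -- Extension by zero allows both parameters to range over all of ℝ. Rescaling s by 1 - t ≥ 1/2
  -- then gives the factor 2.
  set H : Plane → ℝ≥0∞ := P.indicator G with hH
  have hHm : Measurable H := hG.indicator h.isOpen.measurableSet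
  have hin : ∀ t ∈ Ioc (0 : ℝ) (1 / 2), ∫⁻ s in Ioo (0 : ℝ) 1,
      G ((a + s • (b - a)) + t • (y - (a + s • (b - a)))) ≤
      2 * ∫⁻ s : ℝ, H (a + t • (y - a) + s • (b - a)) := by
    intro t ht
    have e : ∀ s ∈ Ioo (0 : ℝ) 1, G ((a + s • (b - a)) + t • (y - (a + s • (b - a)))) =
        H (a + t • (y - a) + ((1 - t) * s) • (b - a)) := by
      intro s hs
      have hm := h.mem_of_closure (edge_mem_closure hab (Ioo_subset_Icc_self hs))
        (h.half_subset hy) ht.1 (by linarith [ht.2])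
      have e' : a + t • (y - a) + ((1 - t) * s) • (b - a) =
        (a + s • (b - a)) + t • (y - (a + s • (b - a))) := by module
      rw [e', hH, indicator_of_mem hm]
    rw [setLIntegral_congr_fun measurableSet_Ioo e]
    refine (setLIntegral_le_lintegral _ _).trans ?_
    rw [lintegral_comp_mul_left_real (H := fun s => H (a + t • (y - a) + s • (b - a)))
      (by fun_prop) (by linarith [ht.2])]
    gcongr
    refine ENNReal.ofReal_le_of_le_toReal ?_
    rw [inv_le_comm₀ (by linarith [ht.2]) (by norm_num)]
    norm_num
    linarith [ht.2]
  refine (setLIntegral_mono' measurableSet_Ioc hin).trans ?_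
  rw [lintegral_const_mul _ (by
    refine Measurable.lintegral_prod_right' (f := fun q : ℝ × ℝ =>
      H (a + q.1 • (y - a) + q.2 • (b - a))) (by fun_prop)), mul_assoc]
  gcongr
  refine (setLIntegral_le_lintegral _ _).trans ?_
  rw [lintegral_comp_parallelogram hHm _ _ _ (abs_pos.1 (hc0.trans_le hc)), hH,
    lintegral_indicator h.isOpen.measurableSet]
  gcongr

/-- Near the edge (t ≤ 1/2) the integral over (t, s) is an area integral for each y; away from it
the integral over y is one for each (t, s). -/
theorem lintegral_edge_ray_le {G : Plane → ℝ≥0∞} (hG : Measurable G) {a b : Plane}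
    (hab : segment ℝ a b ⊆ frontier P) (hne : a ≠ b) :
    ∫⁻ s in Ioo (0 : ℝ) 1, ∫⁻ y in Metric.ball c (r / 2), ∫⁻ t in Ioo (0 : ℝ) 1,
        G ((a + s • (b - a)) + t • (y - (a + s • (b - a)))) ≤
      (2 * ENNReal.ofReal (r / 2 * ‖b - a‖)⁻¹ * volume (Metric.ball c (r / 2)) + 4) *
        ∫⁻ z in P, G z := by
  set F : ℝ → Plane → ℝ → ℝ≥0∞ := fun s y t =>
    G ((a + s • (b - a)) + t • (y - (a + s • (b - a)))) with hF
  have hFm : Measurable fun q : ℝ × Plane × ℝ => F q.1 q.2.1 q.2.2 := by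
    simp only [hF]; fun_prop
  have hsub : Ioo (0 : ℝ) 1 ⊆ Ioc 0 (1 / 2) ∪ Ioo (1 / 2) 1 := by
    intro t ht
    rcases le_or_gt t (1 / 2) with h2 | h2
    · exact Or.inl ⟨ht.1, h2⟩
    · exact Or.inr ⟨h2, ht.2⟩
  have hmeas : ∀ T : Set ℝ, Measurable fun q : ℝ × Plane => ∫⁻ t in T, F q.1 q.2 t := fun T => by
    refine Measurable.lintegral_prod_right' (f := fun q : (ℝ × Plane) × ℝ =>
      F q.1.1 q.1.2 q.2) (by fun_prop)
  have hmeas1 : ∀ (T : Set ℝ) (s : ℝ), Measurable fun y : Plane => ∫⁻ t in T, F s y t :=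
    fun T s => (hmeas T).comp (measurable_prodMk_left (x := s))
  have hmeas2 : ∀ T : Set ℝ, Measurable fun s : ℝ => ∫⁻ y in Metric.ball c (r / 2),
      ∫⁻ t in T, F s y t := fun T => Measurable.lintegral_prod_right' (hmeas T)
  have hstep : ∫⁻ s in Ioo (0 : ℝ) 1, ∫⁻ y in Metric.ball c (r / 2), ∫⁻ t in Ioo (0 : ℝ) 1,
      F s y t ≤ (∫⁻ s in Ioo (0 : ℝ) 1, ∫⁻ y in Metric.ball c (r / 2),
        ∫⁻ t in Ioc (0 : ℝ) (1 / 2), F s y t) + ∫⁻ s in Ioo (0 : ℝ) 1,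
        ∫⁻ y in Metric.ball c (r / 2), ∫⁻ t in Ioo (1 / 2 : ℝ) 1, F s y t := by
    rw [← lintegral_add_left (hmeas2 _)]
    refine lintegral_mono fun s => ?_
    rw [← lintegral_add_left (hmeas1 _ _)]
    refine lintegral_mono fun y => ?_
    exact (lintegral_mono_set hsub).trans (lintegral_union_le _ _ _)
  refine hstep.trans ?_
  rw [add_mul]
  refine add_le_add ?_ ?_
  · rw [lintegral_lintegral_swap (hmeas _).aemeasurable]
    have key : ∀ y ∈ Metric.ball c (r / 2), ∫⁻ s in Ioo (0 : ℝ) 1, ∫⁻ t in Ioc (0 : ℝ) (1 / 2),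
        F s y t ≤ 2 * ENNReal.ofReal (r / 2 * ‖b - a‖)⁻¹ * ∫⁻ z in P, G z := by
      intro y hy
      rw [lintegral_lintegral_swap (by
        exact (by fun_prop : Measurable _).aemeasurable)]
      exact h.lintegral_edge_near_le hG hab hne hy
    refine (setLIntegral_mono' measurableSet_ball key).trans ?_
    rw [setLIntegral_const, mul_right_comm]
  · have key : ∀ s ∈ Ioo (0 : ℝ) 1, ∫⁻ y in Metric.ball c (r / 2), ∫⁻ t in Ioo (1 / 2 : ℝ) 1,
        F s y t ≤ 4 * ∫⁻ z in P, G z := by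
      intro s hs
      rw [lintegral_lintegral_swap (by
        exact (by fun_prop : Measurable _).aemeasurable)]
      refine (setLIntegral_mono' measurableSet_Ioo fun t ht => h.lintegral_half_ray_le_four hG
        (edge_mem_closure hab (Ioo_subset_Icc_self hs)) ht.1.le ht.2.le).trans ?_
      rw [setLIntegral_const]
      refine mul_le_of_le_one_right' ?_
      rw [Real.volume_Ioo]
      norm_num
    refine (setLIntegral_mono' measurableSet_Ioo key).trans ?_
    simp

end StarBall

/-! ### Distance of a smooth function to its average -/

instance isFiniteMeasure_restrict_ball (c : Plane) (r : ℝ) :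
    IsFiniteMeasure (volume.restrict (Metric.ball c r)) :=
  ⟨by rw [Measure.restrict_apply_univ]; exact measure_ball_lt_top⟩

theorem integrableOn_ball {φ : Plane → ℝ} (hφ : Continuous φ) (c : Plane) (r : ℝ) :
    IntegrableOn φ (Metric.ball c r) :=
  (hφ.continuousOn.integrableOn_compact (isCompact_closedBall c r)).mono_set
    Metric.ball_subset_closedBall

namespace StarBall

variable {P : Set Plane} {c : Plane} {r : ℝ} (h : StarBall P c r)
include h

theorem const_sub_average {φ : Plane → ℝ} (hφ : Continuous φ) (k : ℝ) :
    k - ⨍ y in Metric.ball c (r / 2), φ y = ⨍ y in Metric.ball c (r / 2), (k - φ y) := by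
  have h0 := h.measure_half_ne_zero
  have ht : volume (Metric.ball c (r / 2)) ≠ ⊤ := measure_ball_lt_top.ne
  have h1 : (volume.real (Metric.ball c (r / 2))) ≠ 0 := (ENNReal.toReal_pos h0 ht).ne'
  rw [setAverage_eq, setAverage_eq, integral_sub (integrable_const k) (integrableOn_ball hφ _ _)]
  simp only [integral_const, smul_eq_mul, measureReal_restrict_apply_univ]
  field_simp

theorem measure_mul_enorm_sub_average_sq_le {φ : Plane → ℝ} (hφ : Continuous φ) (k : ℝ) :
    volume (Metric.ball c (r / 2)) * ‖k - ⨍ y in Metric.ball c (r / 2), φ y‖ₑ ^ 2 ≤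
      ∫⁻ y in Metric.ball c (r / 2), ‖k - φ y‖ₑ ^ 2 := by
  rw [h.const_sub_average hφ]
  have := sq_enorm_average_le (μ := volume.restrict (Metric.ball c (r / 2)))
    (f := fun y => k - φ y) (by fun_prop)
  simpa using this

theorem measure_mul_enorm_average_sq_le {φ : Plane → ℝ} (hφ : Continuous φ) :
    volume (Metric.ball c (r / 2)) * ‖⨍ y in Metric.ball c (r / 2), φ y‖ₑ ^ 2 ≤
      ∫⁻ y in P, ‖φ y‖ₑ ^ 2 := by
  have := h.measure_mul_enorm_sub_average_sq_le hφ 0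
  simp only [zero_sub, enorm_neg] at this
  exact this.trans (lintegral_mono_set h.half_subset_set)

theorem measure_mul_enorm_sub_average_sq_le_ray {φ : Plane → ℝ} (hφ : ContDiff ℝ ∞ φ) {x : Plane}
    (hx : x ∈ closure P) :
    volume (Metric.ball c (r / 2)) * ‖φ x - ⨍ y in Metric.ball c (r / 2), φ y‖ₑ ^ 2 ≤
      ENNReal.ofReal (Metric.diam P) ^ 2 * ∫⁻ y in Metric.ball c (r / 2),
        ∫⁻ t in Ioo (0 : ℝ) 1, gradSq φ (x + t • (y - x)) := by
  have hG := measurable_gradSq hφ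
  refine (h.measure_mul_enorm_sub_average_sq_le hφ.continuous _).trans ?_
  rw [← lintegral_const_mul _ (by
    refine Measurable.lintegral_prod_right' (f := fun q : Plane × ℝ =>
      gradSq φ (x + q.2 • (q.1 - x))) (by fun_prop))]
  refine setLIntegral_mono' measurableSet_ball fun y hy => ?_
  refine (enorm_sub_sq_le_ray hφ x y).trans ?_
  gcongr
  exact h.enorm_sub_le hx (subset_closure (h.half_subset_set hy))

theorem measure_mul_lintegral_sub_average_le {φ : Plane → ℝ} (hφ : ContDiff ℝ ∞ φ) :
    volume (Metric.ball c (r / 2)) *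
        ∫⁻ x in P, ‖φ x - ⨍ y in Metric.ball c (r / 2), φ y‖ₑ ^ 2 ≤
      ENNReal.ofReal (Metric.diam P) ^ 2 *
        (4 * (volume (Metric.ball c (r / 2)) + volume P) * ∫⁻ z in P, gradSq φ z) := by
  have hG := measurable_gradSq hφ
  have hc := hφ.continuous
  rw [← lintegral_const_mul _ (by fun_prop)]
  refine (setLIntegral_mono' h.isOpen.measurableSet fun x hx =>
    h.measure_mul_enorm_sub_average_sq_le_ray hφ (subset_closure hx)).trans ?_
  rw [lintegral_const_mul _ (by
    refine Measurable.lintegral_prod_right' (f := fun q : Plane × Plane =>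
      ∫⁻ t in Ioo (0 : ℝ) 1, gradSq φ (q.1 + t • (q.2 - q.1))) ?_
    refine Measurable.lintegral_prod_right' (f := fun q : (Plane × Plane) × ℝ =>
      gradSq φ (q.1.1 + q.2 • (q.1.2 - q.1.1))) (by fun_prop))]
  gcongr
  exact h.lintegral_lintegral_ray_le hG

theorem measure_mul_lintegral_edge_sub_average_le {φ : Plane → ℝ} (hφ : ContDiff ℝ ∞ φ)
    {a b : Plane} (hab : segment ℝ a b ⊆ frontier P) (hne : a ≠ b) :
    volume (Metric.ball c (r / 2)) * ∫⁻ s in Ioo (0 : ℝ) 1,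
        ‖φ (a + s • (b - a)) - ⨍ y in Metric.ball c (r / 2), φ y‖ₑ ^ 2 ≤
      ENNReal.ofReal (Metric.diam P) ^ 2 * ((2 * ENNReal.ofReal (r / 2 * ‖b - a‖)⁻¹ *
        volume (Metric.ball c (r / 2)) + 4) * ∫⁻ z in P, gradSq φ z) := by
  have hG := measurable_gradSq hφ
  have hc := hφ.continuous
  rw [← lintegral_const_mul _ (Continuous.measurable (by fun_prop))]
  refine (setLIntegral_mono' measurableSet_Ioo fun s hs =>
    h.measure_mul_enorm_sub_average_sq_le_ray hφ
      (edge_mem_closure hab (Ioo_subset_Icc_self hs))).trans ?_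
  rw [lintegral_const_mul _ (by
    refine Measurable.lintegral_prod_right' (f := fun q : ℝ × Plane =>
      ∫⁻ t in Ioo (0 : ℝ) 1, gradSq φ ((a + q.1 • (b - a)) + t • (q.2 - (a + q.1 • (b - a))))) ?_
    refine Measurable.lintegral_prod_right' (f := fun q : (ℝ × Plane) × ℝ =>
      gradSq φ ((a + q.1.1 • (b - a)) + q.2 • (q.1.2 - (a + q.1.1 • (b - a))))) (by fun_prop))]
  gcongr
  exact h.lintegral_edge_ray_le hG hab hne

/-- The weight t² cancels the Jacobian t⁻² exactly, so the bound holds for each single x, including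
boundary points. -/
theorem lintegral_weighted_ray_le {G : Plane → ℝ≥0∞} (hG : Measurable G) {x : Plane}
    (hx : x ∈ closure P) :
    ∫⁻ y in Metric.ball c (r / 2), ∫⁻ t in Ioo (0 : ℝ) 1, ‖t‖ₑ ^ 2 * G (x + t • (y - x)) ≤
      ∫⁻ z in P, G z := by
  rw [lintegral_lintegral_swap (by exact (by fun_prop : Measurable _).aemeasurable)]
  have key : ∀ t ∈ Ioo (0 : ℝ) 1, ∫⁻ y in Metric.ball c (r / 2),
      ‖t‖ₑ ^ 2 * G (x + t • (y - x)) ≤ ∫⁻ z in P, G z := by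
    intro t ht
    rw [lintegral_const_mul _ (by fun_prop)]
    refine (mul_le_mul_right (h.lintegral_half_ray_le hG hx ht.1 ht.2.le) _).trans_eq ?_
    have ht2 : 0 < t ^ 2 := pow_pos ht.1 2
    rw [Real.enorm_eq_ofReal ht.1.le, ← ENNReal.ofReal_pow ht.1.le, ← mul_assoc,
      ← ENNReal.ofReal_mul ht2.le, mul_inv_cancel₀ ht2.ne']
    simp
  refine (setLIntegral_mono' measurableSet_Ioo key).trans ?_
  simp

theorem measure_mul_enorm_sub_average_sq_le_hess {φ : Plane → ℝ} (hφ : ContDiff ℝ ∞ φ) {x : Plane}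
    (hx : x ∈ closure P) :
    volume (Metric.ball c (r / 2)) * ‖φ x - ⨍ y in Metric.ball c (r / 2), φ y‖ₑ ^ 2 ≤
      2 * (ENNReal.ofReal (Metric.diam P) ^ 2 * (∫⁻ z in P, gradSq φ z) +
        ENNReal.ofReal (Metric.diam P) ^ 4 * ∫⁻ z in P, hessSq φ z) := by
  have hG := measurable_gradSq hφ
  have hH := measurable_hessSq hφ
  refine (h.measure_mul_enorm_sub_average_sq_le hφ.continuous _).trans ?_
  have key : ∀ y ∈ Metric.ball c (r / 2), ‖φ x - φ y‖ₑ ^ 2 ≤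
      2 * (ENNReal.ofReal (Metric.diam P) ^ 2 * gradSq φ y) + 2 * (ENNReal.ofReal (Metric.diam P) ^ 4 *
        ∫⁻ t in Ioo (0 : ℝ) 1, ‖t‖ₑ ^ 2 * hessSq φ (x + t • (y - x))) := by
    intro y hy
    have hd := h.enorm_sub_le hx (subset_closure (h.half_subset_set hy))
    have e : φ x - φ y = -(∑ i, (y - x) i * partialDeriv i φ y) +
      (φ x - φ y + ∑ i, (y - x) i * partialDeriv i φ y) := by ring
    rw [e]
    refine (enorm_add_sq_le _ _).trans ?_
    rw [enorm_neg]
    gcongr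
    · refine (enorm_sum_mul_sq_le _ _).trans ?_
      rw [gradSq]
      gcongr
    · refine (enorm_taylor_sq_le_ray hφ x y).trans ?_
      gcongr
  refine (setLIntegral_mono' measurableSet_ball key).trans ?_
  have hm : Measurable fun y : Plane =>
      ∫⁻ t in Ioo (0 : ℝ) 1, ‖t‖ₑ ^ 2 * hessSq φ (x + t • (y - x)) := by
    refine Measurable.lintegral_prod_right' (f := fun q : Plane × ℝ =>
      ‖q.2‖ₑ ^ 2 * hessSq φ (x + q.2 • (q.1 - x))) (by fun_prop)
  rw [lintegral_add_left (by fun_prop), lintegral_const_mul _ (by fun_prop),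
    lintegral_const_mul _ (by fun_prop), lintegral_const_mul _ (by fun_prop),
    lintegral_const_mul _ hm, mul_add]
  refine add_le_add ?_ (mul_le_mul_right
    (mul_le_mul_right (h.lintegral_weighted_ray_le hH hx) _) _)
  gcongr
  exact h.half_subset_set

end StarBall

/-- Uniform constants: on a domain that is star-shaped with respect to a ball of radius comparable
to its diameter, a smooth function is close to its average over the concentric half ball. -/
theorem exists_const_sub_average {ρ : ℝ} (hρ : 0 < ρ) : ∃ K : ℝ, 0 < K ∧
    ∀ (P : Set Plane) (c : Plane), 0 < Metric.diam P → StarBall P c (ρ * Metric.diam P) →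
    ∀ φ : Plane → ℝ, ContDiff ℝ ∞ φ →
    (∫⁻ x in P, ‖φ x - ⨍ y in Metric.ball c (ρ * Metric.diam P / 2), φ y‖ₑ ^ 2 ≤
      ENNReal.ofReal K * (ENNReal.ofReal (Metric.diam P) ^ 2 * ∫⁻ z in P, gradSq φ z)) ∧
    (∀ a b : Plane, segment ℝ a b ⊆ frontier P → ρ * Metric.diam P ≤ ‖b - a‖ →
      ∫⁻ s in Ioo (0 : ℝ) 1,
        ‖φ (a + s • (b - a)) - ⨍ y in Metric.ball c (ρ * Metric.diam P / 2), φ y‖ₑ ^ 2 ≤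
      ENNReal.ofReal K * ∫⁻ z in P, gradSq φ z) ∧
    (∀ x ∈ closure P, ‖φ x - ⨍ y in Metric.ball c (ρ * Metric.diam P / 2), φ y‖ₑ ^ 2 ≤
      ENNReal.ofReal K * ((∫⁻ z in P, gradSq φ z) +
        ENNReal.ofReal (Metric.diam P) ^ 2 * ∫⁻ z in P, hessSq φ z)) := by
  set β : ℝ := (volume (Metric.ball (0 : Plane) 1)).toReal with hβ
  have hβt : volume (Metric.ball (0 : Plane) 1) ≠ ⊤ := measure_ball_lt_top.ne
  have hβ0 : 0 < β := ENNReal.toReal_pos (Metric.measure_ball_pos _ _ one_pos).ne' hβt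
  -- The three groups of summands serve the three estimates in turn.
  refine ⟨4 * (1 + 4 / ρ ^ 2) + (2 * (2 / ρ ^ 2) + 4 * (4 / (ρ ^ 2 * β))) +
    2 * (4 / (ρ ^ 2 * β)), by positivity, fun P c hd h φ hφ => ?_⟩
  set d := Metric.diam P with hd'
  set B := volume (Metric.ball c (ρ * d / 2)) with hB
  set D := ∫⁻ z in P, gradSq φ z
  set D2 := ∫⁻ z in P, hessSq φ z
  have hB0 : B ≠ 0 := h.measure_half_ne_zero
  have hBt : B ≠ ⊤ := measure_ball_lt_top.ne
  -- The area of the half ball is comparable to d² and to the area of P, with ratios depending on ρ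
  -- only.
  have hBe : B = ENNReal.ofReal ((ρ * d / 2) ^ 2 * β) := by
    rw [hB, Measure.addHaar_ball _ _ (by positivity), ENNReal.ofReal_mul (by positivity), hβ,
      ENNReal.ofReal_toReal hβt]
    simp
  have hP : volume P ≤ ENNReal.ofReal (4 / ρ ^ 2) * B := by
    have hsub : P ⊆ Metric.closedBall c d := fun x hx => by
      rw [Metric.mem_closedBall, dist_eq_norm]
      exact h.norm_sub_le (subset_closure (h.ball_subset (Metric.mem_ball_self h.pos)))
        (subset_closure hx)
    refine (measure_mono hsub).trans_eq ?_
    rw [Measure.addHaar_closedBall _ _ hd.le, hBe, ← ENNReal.ofReal_mul (by positivity),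
      ← ENNReal.ofReal_toReal hβt, ← hβ, ← ENNReal.ofReal_mul (by positivity)]
    congr 1
    simp
    field_simp
    norm_num
  have hdB : ENNReal.ofReal d ^ 2 = B * ENNReal.ofReal (4 / (ρ ^ 2 * β)) := by
    rw [hBe, ← ENNReal.ofReal_mul (by positivity), ← ENNReal.ofReal_pow hd.le]
    congr 1
    field_simp
    norm_num
  have e4 : (4 : ℝ≥0∞) = ENNReal.ofReal 4 := by simp
  have e2 : (2 : ℝ≥0∞) = ENNReal.ofReal 2 := by simp
  refine ⟨?_, fun a b hab hl => ?_, fun x hx => ?_⟩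
  · refine (ENNReal.mul_le_mul_iff_right hB0 hBt).1
      ((h.measure_mul_lintegral_sub_average_le hφ).trans ?_)
    calc _ ≤ ENNReal.ofReal d ^ 2 * (4 * (B + ENNReal.ofReal (4 / ρ ^ 2) * B) * D) := by gcongr
      _ = B * ((4 * (1 + ENNReal.ofReal (4 / ρ ^ 2))) * (ENNReal.ofReal d ^ 2 * D)) := by ring
      _ ≤ _ := by
        gcongr
        rw [e4, ← ENNReal.ofReal_one, ← ENNReal.ofReal_add (by positivity) (by positivity),
          ← ENNReal.ofReal_mul (by positivity)]
        refine ENNReal.ofReal_le_ofReal ?_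
        have : 0 ≤ (2 * (2 / ρ ^ 2) + 4 * (4 / (ρ ^ 2 * β))) + 2 * (4 / (ρ ^ 2 * β)) := by
          positivity
        linarith
  · have hne : a ≠ b := by
      rintro rfl
      simp only [sub_self, norm_zero] at hl
      exact absurd h.pos (not_lt.2 hl)
    refine (ENNReal.mul_le_mul_iff_right hB0 hBt).1
      ((h.measure_mul_lintegral_edge_sub_average_le hφ hab hne).trans ?_)
    -- The lower bound on the edge length makes this quantity scale-invariant.
    have h1 : ENNReal.ofReal d ^ 2 * ENNReal.ofReal (ρ * d / 2 * ‖b - a‖)⁻¹ ≤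
        ENNReal.ofReal (2 / ρ ^ 2) := by
      rw [← ENNReal.ofReal_pow hd.le, ← ENNReal.ofReal_mul (by positivity)]
      refine ENNReal.ofReal_le_ofReal ?_
      have hp := h.pos
      calc d ^ 2 * (ρ * d / 2 * ‖b - a‖)⁻¹ ≤ d ^ 2 * (ρ * d / 2 * (ρ * d))⁻¹ := by
            gcongr
        _ = 2 / ρ ^ 2 := by field_simp
    calc _ = B * ((2 * (ENNReal.ofReal d ^ 2 * ENNReal.ofReal (ρ * d / 2 * ‖b - a‖)⁻¹)) * D) +
          4 * ENNReal.ofReal d ^ 2 * D := by ring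
      _ ≤ B * ((2 * ENNReal.ofReal (2 / ρ ^ 2)) * D) + 4 * ENNReal.ofReal d ^ 2 * D := by gcongr
      _ = B * ((2 * ENNReal.ofReal (2 / ρ ^ 2) + 4 * ENNReal.ofReal (4 / (ρ ^ 2 * β))) * D) := by
        rw [hdB]; ring
      _ ≤ _ := by
        gcongr
        rw [e4, e2, ← ENNReal.ofReal_mul (by positivity), ← ENNReal.ofReal_mul (by positivity),
          ← ENNReal.ofReal_add (by positivity) (by positivity)]
        refine ENNReal.ofReal_le_ofReal ?_
        have : 0 ≤ 4 * (1 + 4 / ρ ^ 2) + 2 * (4 / (ρ ^ 2 * β)) := by positivity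
        linarith
  · refine (ENNReal.mul_le_mul_iff_right hB0 hBt).1
      ((h.measure_mul_enorm_sub_average_sq_le_hess hφ hx).trans ?_)
    calc _ = 2 * ENNReal.ofReal d ^ 2 * (D + ENNReal.ofReal d ^ 2 * D2) := by ring
      _ = B * ((2 * ENNReal.ofReal (4 / (ρ ^ 2 * β))) * (D + ENNReal.ofReal d ^ 2 * D2)) := by
        rw [hdB]; ring
      _ ≤ _ := by
        gcongr
        rw [e2, ← ENNReal.ofReal_mul (by positivity)]
        refine ENNReal.ofReal_le_ofReal ?_
        have : 0 ≤ 4 * (1 + 4 / ρ ^ 2) + (2 * (2 / ρ ^ 2) + 4 * (4 / (ρ ^ 2 * β))) := by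
          positivity
        linarith

/-! ### Convex weights and real-valued norms -/

theorem exists_weights_of_mem_convexHull {ι : Type*} [Fintype ι] {a : ι → ℝ} {x : ℝ}
    (hx : x ∈ convexHull ℝ (range a)) :
    ∃ w : ι → ℝ, (∀ j, 0 ≤ w j) ∧ ∑ j, w j = 1 ∧ ∑ j, w j * a j = x := by
  classical
  have hsub : convexHull ℝ (range a) ⊆ (Fintype.linearCombination ℝ a) '' stdSimplex ℝ ι := by
    refine convexHull_min ?_ ((convex_stdSimplex ℝ ι).linear_image _)
    rintro _ ⟨j, rfl⟩
    exact ⟨Pi.single j 1, single_mem_stdSimplex ℝ j, by simp⟩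
  obtain ⟨w, hw, rfl⟩ := hsub hx
  exact ⟨w, hw.1, hw.2, by simp [Fintype.linearCombination_apply]⟩

theorem lintegral_enorm_sq_eq {α : Type*} [MeasurableSpace α] (μ : Measure α) (u : α → ℝ) :
    ∫⁻ x, ‖u x‖ₑ ^ 2 ∂μ = eLpNorm u 2 μ ^ 2 := by
  have := eLpNorm_nnreal_pow_eq_lintegral (μ := μ) (f := u) (p := 2) (by norm_num)
  simpa using this.symm

theorem ofReal_l2Norm {P : Set Plane} {u : Plane → ℝ} (hu : MemLp u 2 (volume.restrict P)) :
    ENNReal.ofReal (l2Norm P u) = eLpNorm u 2 (volume.restrict P) :=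
  ENNReal.ofReal_toReal hu.eLpNorm_ne_top

theorem l2Norm_nonneg (P : Set Plane) (u : Plane → ℝ) : 0 ≤ l2Norm P u := ENNReal.toReal_nonneg

theorem l2Norm_le_of_lintegral_le {P : Set Plane} {u : Plane → ℝ} {M : ℝ} (hM : 0 ≤ M)
    (h : ∫⁻ x in P, ‖u x‖ₑ ^ 2 ≤ ENNReal.ofReal (M ^ 2)) : l2Norm P u ≤ M := by
  rw [lintegral_enorm_sq_eq, ENNReal.ofReal_pow hM] at h
  exact ENNReal.toReal_le_of_le_ofReal hM ((ENNReal.pow_le_pow_left_iff two_ne_zero).1 h)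

theorem l2Norm_add_le {P : Set Plane} {u v : Plane → ℝ} (hu : MemLp u 2 (volume.restrict P))
    (hv : MemLp v 2 (volume.restrict P)) : l2Norm P (u + v) ≤ l2Norm P u + l2Norm P v := by
  unfold l2Norm
  rw [← ENNReal.toReal_add hu.eLpNorm_ne_top hv.eLpNorm_ne_top]
  exact ENNReal.toReal_mono (ENNReal.add_ne_top.2 ⟨hu.eLpNorm_ne_top, hv.eLpNorm_ne_top⟩)
    (eLpNorm_add_le hu.1 hv.1 (by norm_num))

theorem l2Norm_sub_comm (P : Set Plane) (u v : Plane → ℝ) :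
    l2Norm P (u - v) = l2Norm P (v - u) := by
  unfold l2Norm
  rw [eLpNorm_sub_comm]

theorem tendsto_l2Norm {P : Set Plane} {φ : ℕ → Plane → ℝ} {u : Plane → ℝ}
    (hφ : ∀ n, MemLp (φ n) 2 (volume.restrict P)) (hu : MemLp u 2 (volume.restrict P))
    (h : Tendsto (fun n => eLpNorm (φ n - u) 2 (volume.restrict P)) atTop (𝓝 0)) :
    Tendsto (fun n => l2Norm P (φ n)) atTop (𝓝 (l2Norm P u)) := by
  have h' : Tendsto (fun n => l2Norm P (φ n - u)) atTop (𝓝 0) :=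
    (ENNReal.tendsto_toReal ENNReal.zero_ne_top).comp h
  refine tendsto_iff_dist_tendsto_zero.2
    (squeeze_zero (fun _ => dist_nonneg) (fun n => ?_) h')
  rw [Real.dist_eq, abs_sub_le_iff]
  have h1 := l2Norm_add_le ((hφ n).sub hu) hu
  have h2 := l2Norm_add_le (hu.sub (hφ n)) (hφ n)
  rw [sub_add_cancel] at h1 h2
  rw [l2Norm_sub_comm] at h2
  constructor <;> linarith

theorem memLp_of_continuous {μ : Measure Plane} [IsFiniteMeasure μ] {S : Set Plane}
    (hS : Bornology.IsBounded S) (hμ : ∀ᵐ x ∂μ, x ∈ S) {φ : Plane → ℝ} (hφ : Continuous φ)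
    (q : ℝ≥0∞) : MemLp φ q μ := by
  obtain ⟨C, hC⟩ := hS.isCompact_closure.exists_bound_of_continuousOn hφ.continuousOn
  refine MemLp.of_bound hφ.aestronglyMeasurable C ?_
  filter_upwards [hμ] with x hx using hC x (subset_closure hx)

theorem lintegral_gradSq_eq (P : Set Plane) {ψ : Plane → ℝ} (hψ : ContDiff ℝ ∞ ψ) :
    ∫⁻ z in P, gradSq ψ z = ∑ i, eLpNorm (partialDeriv i ψ) 2 (volume.restrict P) ^ 2 := by
  unfold gradSq
  rw [lintegral_finsetSum _ (fun i _ =>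
    ((contDiff_partialDeriv hψ i).continuous.measurable.enorm.pow_const 2))]
  exact Finset.sum_congr rfl fun i _ => lintegral_enorm_sq_eq _ _

theorem lintegral_hessSq_eq (P : Set Plane) {ψ : Plane → ℝ} (hψ : ContDiff ℝ ∞ ψ) :
    ∫⁻ z in P, hessSq ψ z =
      ∑ i, ∑ k, eLpNorm (partialDeriv k (partialDeriv i ψ)) 2 (volume.restrict P) ^ 2 := by
  have hm : ∀ i k, Measurable fun z => ‖partialDeriv k (partialDeriv i ψ) z‖ₑ ^ 2 := fun i k =>
    (contDiff_partialDeriv (contDiff_partialDeriv hψ i) k).continuous.measurable.enorm.pow_const 2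
  unfold hessSq
  rw [lintegral_finsetSum _ (fun i _ => Finset.measurable_fun_sum _ fun k _ => hm i k)]
  refine Finset.sum_congr rfl fun i _ => ?_
  rw [lintegral_finsetSum _ (fun k _ => hm i k)]
  exact Finset.sum_congr rfl fun k _ => lintegral_enorm_sq_eq _ _

/-- The `H¹` seminorm of a smooth function, computed with classical derivatives. -/
noncomputable def smoothH1 (P : Set Plane) (φ : Plane → ℝ) : ℝ :=
  √(∑ i, l2Norm P (partialDeriv i φ) ^ 2)

/-- The `H²` seminorm of a smooth function, computed with classical derivatives. -/
noncomputable def smoothH2 (P : Set Plane) (φ : Plane → ℝ) : ℝ :=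
  √(∑ i, ∑ k, l2Norm P (partialDeriv k (partialDeriv i φ)) ^ 2)

theorem smoothH1_nonneg (P : Set Plane) (φ : Plane → ℝ) : 0 ≤ smoothH1 P φ := Real.sqrt_nonneg _

theorem smoothH2_nonneg (P : Set Plane) (φ : Plane → ℝ) : 0 ≤ smoothH2 P φ := Real.sqrt_nonneg _

namespace StarBall

variable {P : Set Plane} {c : Plane} {r : ℝ} (h : StarBall P c r)
include h

theorem isFiniteMeasure : IsFiniteMeasure (volume.restrict P) :=
  ⟨by rw [Measure.restrict_apply_univ]; exact h.measure_ne_top.lt_top⟩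

theorem memLp {φ : Plane → ℝ} (hφ : Continuous φ) : MemLp φ 2 (volume.restrict P) :=
  have := h.isFiniteMeasure
  memLp_of_continuous h.isBounded (ae_restrict_mem h.isOpen.measurableSet) hφ 2

theorem lintegral_gradSq {φ : Plane → ℝ} (hφ : ContDiff ℝ ∞ φ) :
    ∫⁻ z in P, gradSq φ z = ENNReal.ofReal (smoothH1 P φ ^ 2) := by
  rw [lintegral_gradSq_eq P hφ, smoothH1,
    Real.sq_sqrt (Finset.sum_nonneg fun i _ => sq_nonneg _),
    ENNReal.ofReal_sum_of_nonneg (fun i _ => sq_nonneg _)]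
  refine Finset.sum_congr rfl fun i _ => ?_
  rw [ENNReal.ofReal_pow (l2Norm_nonneg _ _),
    ofReal_l2Norm (h.memLp (contDiff_partialDeriv hφ i).continuous)]

theorem lintegral_hessSq {φ : Plane → ℝ} (hφ : ContDiff ℝ ∞ φ) :
    ∫⁻ z in P, hessSq φ z = ENNReal.ofReal (smoothH2 P φ ^ 2) := by
  rw [lintegral_hessSq_eq P hφ, smoothH2,
    Real.sq_sqrt (Finset.sum_nonneg fun i _ => Finset.sum_nonneg fun k _ => sq_nonneg _),
    ENNReal.ofReal_sum_of_nonneg (fun i _ => Finset.sum_nonneg fun k _ => sq_nonneg _)]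
  refine Finset.sum_congr rfl fun i _ => ?_
  rw [ENNReal.ofReal_sum_of_nonneg (fun i _ => sq_nonneg _)]
  refine Finset.sum_congr rfl fun k _ => ?_
  rw [ENNReal.ofReal_pow (l2Norm_nonneg _ _),
    ofReal_l2Norm (h.memLp (contDiff_partialDeriv (contDiff_partialDeriv hφ i) k).continuous)]

theorem l2Norm_le_of_abs_le {u : Plane → ℝ} {M : ℝ} (hM : 0 ≤ M) (hu : ∀ x ∈ P, |u x| ≤ M) :
    l2Norm P u ≤ √(volume (Metric.ball (0 : Plane) 1)).toReal * Metric.diam P * M := by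
  have hβt : volume (Metric.ball (0 : Plane) 1) ≠ ⊤ := measure_ball_lt_top.ne
  set β : ℝ := (volume (Metric.ball (0 : Plane) 1)).toReal with hβ
  have hβ0 : 0 ≤ β := ENNReal.toReal_nonneg
  have hd : 0 ≤ Metric.diam P := Metric.diam_nonneg
  refine l2Norm_le_of_lintegral_le (by positivity) ?_
  have hsub : P ⊆ Metric.closedBall c (Metric.diam P) := fun x hx => by
    rw [Metric.mem_closedBall, dist_eq_norm]
    exact h.norm_sub_le (subset_closure (h.ball_subset (Metric.mem_ball_self h.pos)))
      (subset_closure hx)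
  have hle : ∀ x ∈ P, ‖u x‖ₑ ^ 2 ≤ ENNReal.ofReal M ^ 2 := fun x hx => by
    rw [Real.enorm_eq_ofReal_abs]
    gcongr
    exact hu x hx
  refine (setLIntegral_mono' h.isOpen.measurableSet hle).trans ?_
  rw [setLIntegral_const]
  refine (mul_le_mul_right (measure_mono hsub) _).trans_eq ?_
  rw [Measure.addHaar_closedBall _ _ hd, ← ENNReal.ofReal_toReal hβt, ← hβ,
    ← ENNReal.ofReal_mul (by positivity), ← ENNReal.ofReal_pow hM,
    ← ENNReal.ofReal_mul (by positivity), mul_pow, mul_pow, Real.sq_sqrt hβ0]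
  congr 1
  simp
  ring

end StarBall

theorem abs_le_of_enorm_sq_le {a M : ℝ} (hM : 0 ≤ M)
    (h : ‖a‖ₑ ^ 2 ≤ ENNReal.ofReal (M ^ 2)) : |a| ≤ M := by
  rw [ENNReal.ofReal_pow hM] at h
  have := (ENNReal.pow_le_pow_left_iff two_ne_zero).1 h
  rw [Real.enorm_eq_ofReal_abs] at this
  exact (ENNReal.ofReal_le_ofReal_iff hM).1 this

theorem abs_setIntegral_Ioo_le {g : ℝ → ℝ} (hg : Continuous g) {M : ℝ} (hM : 0 ≤ M)
    (h : ∫⁻ s in Ioo (0 : ℝ) 1, ‖g s‖ₑ ^ 2 ≤ ENNReal.ofReal (M ^ 2)) :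
    |∫ s in Ioo (0 : ℝ) 1, g s| ≤ M := by
  refine abs_le_of_enorm_sq_le hM ?_
  refine (pow_le_pow_left' (enorm_integral_le_lintegral_enorm _) 2).trans ?_
  refine (sq_lintegral_le _ hg.measurable.enorm.aemeasurable).trans ?_
  simpa using h

/-! ### Poincaré estimates for smooth functions -/

/-- Real-valued form of `exists_const_sub_average`. -/
theorem exists_const_near_constant {ρ : ℝ} (hρ : 0 < ρ) : ∃ K : ℝ, 0 < K ∧
    ∀ (P : Set Plane) (c : Plane), 0 < Metric.diam P → StarBall P c (ρ * Metric.diam P) →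
    ∀ φ : Plane → ℝ, ContDiff ℝ ∞ φ → ∃ m : ℝ,
    l2Norm P (fun x => φ x - m) ≤ K * (Metric.diam P * smoothH1 P φ) ∧
    (∀ a b : Plane, segment ℝ a b ⊆ frontier P → ρ * Metric.diam P ≤ ‖b - a‖ →
      |∫ s in Ioo (0 : ℝ) 1, (φ (a + s • (b - a)) - m)| ≤ K * smoothH1 P φ) ∧
    (∀ x ∈ closure P, |φ x - m| ≤ K * (smoothH1 P φ + Metric.diam P * smoothH2 P φ)) := by
  obtain ⟨K, hK, hmain⟩ := exists_const_sub_average hρ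
  refine ⟨√K, Real.sqrt_pos.2 hK, fun P c hd h φ hφ =>
    ⟨⨍ y in Metric.ball c (ρ * Metric.diam P / 2), φ y, ?_, fun a b hab hl => ?_,
    fun x hx => ?_⟩⟩
  all_goals
    have h1 := smoothH1_nonneg P φ
    have h2 := smoothH2_nonneg P φ
  · refine l2Norm_le_of_lintegral_le (by positivity) (((hmain P c hd h φ hφ).1).trans_eq ?_)
    rw [h.lintegral_gradSq hφ, ← ENNReal.ofReal_pow hd.le, ← ENNReal.ofReal_mul (by positivity),
      ← ENNReal.ofReal_mul hK.le, mul_pow, mul_pow, Real.sq_sqrt hK.le]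
  · have hc := hφ.continuous
    refine abs_setIntegral_Ioo_le (by fun_prop) (by positivity)
      (((hmain P c hd h φ hφ).2.1 a b hab hl).trans_eq ?_)
    rw [h.lintegral_gradSq hφ, ← ENNReal.ofReal_mul hK.le, mul_pow, Real.sq_sqrt hK.le]
  · refine abs_le_of_enorm_sq_le (by positivity) (((hmain P c hd h φ hφ).2.2 x hx).trans ?_)
    rw [h.lintegral_gradSq hφ, h.lintegral_hessSq hφ, ← ENNReal.ofReal_pow hd.le,
      ← ENNReal.ofReal_mul (by positivity), ← ENNReal.ofReal_add (by positivity) (by positivity),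
      ← ENNReal.ofReal_mul hK.le, mul_pow, Real.sq_sqrt hK.le]
    refine ENNReal.ofReal_le_ofReal (mul_le_mul_of_nonneg_left ?_ hK.le)
    nlinarith [mul_nonneg h1 (mul_nonneg hd.le h2)]

/-- A smooth function on `P` is controlled by its gradient and one convex combination of its edge
integrals, and pointwise by its derivatives and one convex combination of its vertex values. -/
theorem exists_const_smooth {ρ : ℝ} (hρ : 0 < ρ) : ∃ C : ℝ, 0 < C ∧
    ∀ (P : Set Plane) (c : Plane), 0 < Metric.diam P → StarBall P c (ρ * Metric.diam P) →
    ∀ φ : Plane → ℝ, ContDiff ℝ ∞ φ → ∀ (N : ℕ) (a b : Fin N → Plane) (w : Fin N → ℝ),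
    (∀ j, 0 ≤ w j) → ∑ j, w j = 1 → (∀ j, segment ℝ (a j) (b j) ⊆ frontier P) →
    (∀ j, ρ * Metric.diam P ≤ ‖b j - a j‖) →
    l2Norm P φ ≤ C * (Metric.diam P * smoothH1 P φ + |∑ j, w j *
      (‖b j - a j‖ * ∫ s in Ioo (0 : ℝ) 1, φ (a j + s • (b j - a j)))|) ∧
    ∀ x ∈ closure P, |φ x| ≤ C * (smoothH1 P φ + Metric.diam P * smoothH2 P φ) +
      |∑ j, w j * φ (a j)| := by
  obtain ⟨K, hK, hmain⟩ := exists_const_near_constant hρ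
  set β : ℝ := (volume (Metric.ball (0 : Plane) 1)).toReal with hβ
  have hβt : volume (Metric.ball (0 : Plane) 1) ≠ ⊤ := measure_ball_lt_top.ne
  have hβ0 : 0 < β := ENNReal.toReal_pos (Metric.measure_ball_pos _ _ one_pos).ne' hβt
  -- The L² bound uses K for f - m and √β K + √β / ρ for the constant m; the pointwise bound uses
  -- 2K.
  refine ⟨2 * K + √β * K + √β / ρ, by positivity,
    fun P c hd h φ hφ N a b w hw hw1 hab hl => ?_⟩
  obtain ⟨m, hm1, hm2, hm3⟩ := hmain P c hd h φ hφ
  have h1 := smoothH1_nonneg P φ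
  have h2 := smoothH2_nonneg P φ
  have hc := hφ.continuous
  constructor
  · set d := Metric.diam P
    set S := ∑ j, w j * (‖b j - a j‖ * ∫ s in Ioo (0 : ℝ) 1, φ (a j + s • (b j - a j))) with hS
    set L := ∑ j, w j * ‖b j - a j‖ with hL
    -- The lower bound on all edge lengths passes to their weighted mean; it is what permits solving
    -- for m.
    have hLd : ρ * d ≤ L := by
      calc ρ * d = ∑ j, w j * (ρ * d) := by rw [← Finset.sum_mul, hw1, one_mul]
        _ ≤ L := Finset.sum_le_sum fun j _ => mul_le_mul_of_nonneg_left (hl j) (hw j)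
    have hrd : 0 < ρ * d := by positivity
    have hSm : S - L * m = ∑ j, w j * ‖b j - a j‖ *
        ∫ s in Ioo (0 : ℝ) 1, (φ (a j + s • (b j - a j)) - m) := by
      rw [hS, hL, Finset.sum_mul, ← Finset.sum_sub_distrib]
      refine Finset.sum_congr rfl fun j _ => ?_
      rw [integral_sub _ (integrable_const m)]
      · simp
        ring
      · exact ((by fun_prop : Continuous fun s : ℝ =>
          φ (a j + s • (b j - a j))).continuousOn.integrableOn_compact isCompact_Icc).mono_set
            Ioo_subset_Icc_self
    have hSm' : |S - L * m| ≤ L * (K * smoothH1 P φ) := by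
      rw [hSm, hL, Finset.sum_mul]
      refine (Finset.abs_sum_le_sum_abs _ _).trans (Finset.sum_le_sum fun j _ => ?_)
      have hj : 0 ≤ w j * ‖b j - a j‖ := mul_nonneg (hw j) (norm_nonneg _)
      rw [abs_mul, abs_of_nonneg hj]
      exact mul_le_mul_of_nonneg_left (hm2 _ _ (hab j) (hl j)) hj
    have hL0 : 0 < L := hrd.trans_le hLd
    have hm : |m| ≤ |S| / (ρ * d) + K * smoothH1 P φ := by
      have e1 : L * |m| ≤ |S| + L * (K * smoothH1 P φ) := by
        have := abs_sub_abs_le_abs_sub (L * m) S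
        rw [abs_sub_comm, abs_mul, abs_of_pos hL0] at this
        linarith
      have e2 : |m| ≤ |S| / L + K * smoothH1 P φ := by
        rw [← mul_le_mul_iff_right₀ hL0, mul_add, mul_div_cancel₀ _ hL0.ne']
        exact e1
      refine e2.trans ?_
      gcongr
    have hconst : l2Norm P (fun _ => m) ≤ √β * d * |m| := by
      exact h.l2Norm_le_of_abs_le (abs_nonneg m) fun _ _ => le_rfl
    have hsum := l2Norm_add_le (P := P) (u := fun x => φ x - m) (v := fun _ => m)
      (h.memLp (by fun_prop)) (h.memLp (by fun_prop))
    have e : (fun x => φ x - m) + (fun _ => m) = φ := by ext x; simp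
    rw [e] at hsum
    have h3 : √β * d * |m| ≤ √β / ρ * |S| + √β * K * (d * smoothH1 P φ) := by
      calc √β * d * |m| ≤ √β * d * (|S| / (ρ * d) + K * smoothH1 P φ) := by gcongr
        _ = _ := by field_simp
    have p1 : 0 ≤ √β * K := by positivity
    have p2 : 0 ≤ √β / ρ := by positivity
    have p3 := mul_nonneg hd.le h1
    have p4 := abs_nonneg S
    nlinarith [mul_nonneg p1 p4, mul_nonneg p2 p3, mul_nonneg hK.le p3, mul_nonneg hK.le p4]
  · intro x hx
    have hT : ∑ j, w j * φ (a j) - m = ∑ j, w j * (φ (a j) - m) := by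
      simp_rw [mul_sub]
      rw [Finset.sum_sub_distrib, ← Finset.sum_mul, hw1, one_mul]
    have hT' : |∑ j, w j * φ (a j) - m| ≤ K * (smoothH1 P φ + Metric.diam P * smoothH2 P φ) := by
      rw [hT]
      refine (Finset.abs_sum_le_sum_abs _ _).trans ?_
      rw [← one_mul (K * _), ← hw1, Finset.sum_mul]
      refine Finset.sum_le_sum fun j _ => ?_
      rw [abs_mul, abs_of_nonneg (hw j)]
      exact mul_le_mul_of_nonneg_left
        (hm3 _ (frontier_subset_closure (hab j (left_mem_segment ℝ _ _)))) (hw j)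
    have hx' := hm3 x hx
    set M := smoothH1 P φ + Metric.diam P * smoothH2 P φ with hM
    have hM0 : 0 ≤ M := by positivity
    set T := ∑ j, w j * φ (a j)
    have e : |φ x| ≤ |φ x - m| + |T - m| + |T| := by
      have : φ x = (φ x - m) - (T - m) + T := by ring
      calc |φ x| = |(φ x - m) - (T - m) + T| := by rw [← this]
        _ ≤ |(φ x - m) - (T - m)| + |T| := abs_add_le _ _
        _ ≤ _ := by gcongr; exact abs_sub _ _
    have p1 : 0 ≤ √β * K := by positivity
    have p2 : 0 ≤ √β / ρ := by positivity
    nlinarith [mul_nonneg p1 hM0, mul_nonneg p2 hM0]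

/-! ### Arc length on segments -/

/-- The affine parametrisation multiplies one-dimensional Hausdorff measure by the length, and on ℝ
that measure is Lebesgue measure; the endpoints of the parameter interval are null. -/
theorem hausdorffMeasure_restrict_segment (a b : Plane) :
    (Measure.hausdorffMeasure 1 : Measure Plane).restrict (segment ℝ a b) =
      ENNReal.ofReal ‖b - a‖ • Measure.map (fun s : ℝ => a + s • (b - a))
        (volume.restrict (Ioo (0 : ℝ) 1)) := by
  rw [restrict_Ioo_eq_restrict_Icc]
  have hm : Measurable fun s : ℝ => a + s • (b - a) := Continuous.measurable (by fun_prop)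
  have hl : ∀ s : ℝ, AffineMap.lineMap a b s = a + s • (b - a) := fun s => by
    simp [AffineMap.lineMap_apply, add_comm]
  ext S hS
  rw [Measure.restrict_apply hS, Measure.smul_apply, Measure.map_apply hm hS,
    Measure.restrict_apply (hm hS), segment_eq_image', ← image_preimage_inter, inter_comm,
    ← hausdorffMeasure_real]
  have := hausdorffMeasure_lineMap_image a b ((fun s : ℝ => a + s • (b - a)) ⁻¹' S ∩ Icc 0 1)
  simp only [hl] at this
  rw [inter_comm, this, ← dist_eq_norm, dist_comm, ← edist_dist, edist_nndist]
  rfl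

theorem lintegral_segment {G : Plane → ℝ≥0∞} (hG : Measurable G) (a b : Plane) :
    ∫⁻ x in segment ℝ a b, G x ∂(Measure.hausdorffMeasure 1) =
      ENNReal.ofReal ‖b - a‖ * ∫⁻ s in Ioo (0 : ℝ) 1, G (a + s • (b - a)) := by
  rw [hausdorffMeasure_restrict_segment, lintegral_smul_measure,
    lintegral_map hG (Continuous.measurable (by fun_prop)), smul_eq_mul]

theorem integral_segment {φ : Plane → ℝ} (hφ : Continuous φ) (a b : Plane) :
    ∫ x in segment ℝ a b, φ x ∂(Measure.hausdorffMeasure 1) =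
      ‖b - a‖ * ∫ s in Ioo (0 : ℝ) 1, φ (a + s • (b - a)) := by
  rw [hausdorffMeasure_restrict_segment, integral_smul_measure,
    integral_map (Continuous.aemeasurable (by fun_prop)) hφ.aestronglyMeasurable,
    ENNReal.toReal_ofReal (norm_nonneg _), smul_eq_mul]

theorem isFiniteMeasure_hausdorffMeasure_segment (a b : Plane) :
    IsFiniteMeasure ((Measure.hausdorffMeasure 1 : Measure Plane).restrict (segment ℝ a b)) :=
  ⟨by rw [Measure.restrict_apply_univ, hausdorffMeasure_segment]; exact edist_lt_top _ _⟩

theorem lintegral_iUnion_le_sum {α : Type*} [MeasurableSpace α] {N : ℕ} (μ : Measure α)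
    (E : Fin N → Set α) (G : α → ℝ≥0∞) :
    ∫⁻ x in ⋃ j, E j, G x ∂μ ≤ ∑ j, ∫⁻ x in E j, G x ∂μ := by
  refine (lintegral_iUnion_le E G).trans_eq ?_
  rw [tsum_fintype]

theorem isFiniteMeasure_hausdorffMeasure_iUnion_segment {N : ℕ} (a b : Fin N → Plane) :
    IsFiniteMeasure ((Measure.hausdorffMeasure 1 : Measure Plane).restrict
      (⋃ j, segment ℝ (a j) (b j))) := by
  refine ⟨?_⟩
  rw [Measure.restrict_apply_univ]
  refine (measure_iUnion_fintype_le _ _).trans_lt (ENNReal.sum_lt_top.2 fun j _ => ?_)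
  rw [hausdorffMeasure_segment]
  exact edist_lt_top _ _

/-- Convergence in `L²` over a set implies convergence of the integrals over subsets of finite
measure. -/
theorem tendsto_setIntegral_of_tendsto_eLpNorm {μ : Measure Plane} {S T : Set Plane}
    (hST : S ⊆ T) [IsFiniteMeasure (μ.restrict S)] {φ : ℕ → Plane → ℝ} {g : Plane → ℝ}
    (hφ : ∀ n, MemLp (φ n) 2 (μ.restrict T)) (hg : MemLp g 2 (μ.restrict T))
    (h : Tendsto (fun n => eLpNorm (φ n - g) 2 (μ.restrict T)) atTop (𝓝 0)) :
    Tendsto (fun n => ∫ x in S, φ n x ∂μ) atTop (𝓝 (∫ x in S, g x ∂μ)) := by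
  have hle : μ.restrict S ≤ μ.restrict T := Measure.restrict_mono hST le_rfl
  have hφS := fun n => (hφ n).mono_measure hle
  have hgS := hg.mono_measure hle
  refine tendsto_integral_of_L1' g hgS.1
    (Eventually.of_forall fun n => (hφS n).integrable (by norm_num)) ?_
  have hlim : Tendsto (fun n => eLpNorm (φ n - g) 2 (μ.restrict T) *
      (μ.restrict S) univ ^ (1 / (1 : ℝ≥0∞).toReal - 1 / (2 : ℝ≥0∞).toReal)) atTop (𝓝 0) := by
    have := ENNReal.Tendsto.mul_const (b := (μ.restrict S) univ ^
      (1 / (1 : ℝ≥0∞).toReal - 1 / (2 : ℝ≥0∞).toReal)) h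
      (Or.inr (ENNReal.rpow_ne_top_of_nonneg (by norm_num) (measure_ne_top _ _)))
    simpa using this
  refine tendsto_of_tendsto_of_tendsto_of_le_of_le tendsto_const_nhds hlim
    (fun _ => zero_le) fun n => ?_
  refine (eLpNorm_le_eLpNorm_mul_rpow_measure_univ (q := 2) (by norm_num)
    ((hφS n).sub hgS).1).trans ?_
  gcongr

/-! ### Smoothing along rays towards the ball -/

open scoped Convolution

/-- `b` is a smooth function of integral one supported in the half ball. -/
structure IsMollifier (c : Plane) (r : ℝ) (b : Plane → ℝ) : Prop where
  contDiff : ContDiff ℝ ∞ b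
  support_subset : Function.support b ⊆ Metric.closedBall c (r / 2)
  integral_eq : ∫ y, b y = 1

theorem exists_isMollifier (c : Plane) {r : ℝ} (hr : 0 < r) : ∃ b, IsMollifier c r b := by
  let f : ContDiffBump c := ⟨r / 4, r / 2, by positivity, by linarith⟩
  refine ⟨f.normed volume, f.contDiff_normed, ?_, f.integral_normed⟩
  rw [f.support_normed_eq]
  exact Metric.ball_subset_closedBall

/-- The rescaled and reflected kernel. -/
noncomputable def kernel (b : Plane → ℝ) (ε : ℝ) (w : Plane) : ℝ :=
  (ε ^ 2)⁻¹ * b (-(ε⁻¹ • w))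

/-- The average `∫ b y * f ((1 - ε) x + ε y) dy` of `f` over points of rays towards the support
of `b`, written as a convolution so that it makes sense and is smooth on the whole plane. -/
noncomputable def smoothing (P : Set Plane) (b : Plane → ℝ) (ε : ℝ) (f : Plane → ℝ)
    (x : Plane) : ℝ :=
  ∫ z in P, f z * kernel b ε ((1 - ε) • x - z)

theorem kernel_sub (b : Plane → ℝ) (ε : ℝ) (x z : Plane) :
    kernel b ε ((1 - ε) • x - z) = (ε ^ 2)⁻¹ * b (ε⁻¹ • (z - (1 - ε) • x)) := by
  rw [kernel, ← smul_neg, neg_sub]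

namespace IsMollifier

variable {c : Plane} {r : ℝ} {b : Plane → ℝ} (hb : IsMollifier c r b)
include hb

theorem hasCompactSupport : HasCompactSupport b :=
  HasCompactSupport.of_support_subset_isCompact (isCompact_closedBall _ _) hb.support_subset

theorem contDiff_kernel (ε : ℝ) : ContDiff ℝ ∞ (kernel b ε) := by
  unfold kernel
  exact contDiff_const.mul (hb.contDiff.comp (by fun_prop))

theorem hasCompactSupport_kernel {ε : ℝ} (hε : ε ≠ 0) : HasCompactSupport (kernel b ε) := by
  have h1 : HasCompactSupport fun w : Plane => b (-(ε⁻¹ • w)) := by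
    have := hb.hasCompactSupport.comp_homeomorph
      ((Homeomorph.smulOfNeZero ε⁻¹ (inv_ne_zero hε)).trans (Homeomorph.neg Plane))
    exact this
  exact h1.mul_left

end IsMollifier

theorem smoothing_congr {P : Set Plane} {f g : Plane → ℝ} (hfg : f =ᵐ[volume.restrict P] g)
    (b : Plane → ℝ) (ε : ℝ) : smoothing P b ε f = smoothing P b ε g := by
  ext x
  refine integral_congr_ae ?_
  filter_upwards [hfg] with z hz
  rw [hz]

theorem smoothing_eq_convolution {P : Set Plane} (hP : MeasurableSet P) (b : Plane → ℝ) (ε : ℝ)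
    (f : Plane → ℝ) (x : Plane) : smoothing P b ε f x =
      ((P.indicator f) ⋆[ContinuousLinearMap.mul ℝ ℝ, volume] (kernel b ε)) ((1 - ε) • x) := by
  rw [smoothing, convolution_def, ← integral_indicator hP]
  refine integral_congr_ae (Eventually.of_forall fun z => ?_)
  by_cases hz : z ∈ P <;> simp [hz]

namespace StarBall

variable {P : Set Plane} {c : Plane} {r : ℝ} (h : StarBall P c r) {b : Plane → ℝ}
  (hb : IsMollifier c r b)
include h

theorem closedBall_half_subset : Metric.closedBall c (r / 2) ⊆ Metric.ball c r :=
  Metric.closedBall_subset_ball (by linarith [h.pos])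

theorem integrable {f : Plane → ℝ} (hf : MemLp f 2 (volume.restrict P)) :
    Integrable f (volume.restrict P) :=
  have := h.isFiniteMeasure
  hf.integrable (by norm_num)

theorem locallyIntegrable_indicator {f : Plane → ℝ} (hf : MemLp f 2 (volume.restrict P)) :
    LocallyIntegrable (P.indicator f) volume :=
  ((integrable_indicator_iff h.isOpen.measurableSet).2 (h.integrable hf)).locallyIntegrable

include hb

theorem contDiff_smoothing {f : Plane → ℝ} (hf : MemLp f 2 (volume.restrict P)) {ε : ℝ}
    (hε : ε ≠ 0) : ContDiff ℝ ∞ (smoothing P b ε f) := by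
  have e : smoothing P b ε f = fun x =>
      ((P.indicator f) ⋆[ContinuousLinearMap.mul ℝ ℝ, volume] (kernel b ε)) ((1 - ε) • x) :=
    funext fun x => smoothing_eq_convolution h.isOpen.measurableSet b ε f x
  rw [e]
  exact ((hb.hasCompactSupport_kernel hε).contDiff_convolution_right _
    (h.locallyIntegrable_indicator hf) (hb.contDiff_kernel ε)).comp (by fun_prop)

/-- The kernel lives on the points (1 - ε)x + εy with y in the closed half ball, and these lie in P
by star-shapedness. So it is an admissible test function for weak derivatives at every x in P,
however close to the boundary. -/
theorem tsupport_kernel_subset {x : Plane} (hx : x ∈ P) {ε : ℝ} (hε : 0 < ε) (hε1 : ε ≤ 1) :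
    tsupport (fun z => kernel b ε ((1 - ε) • x - z)) ⊆ P := by
  have hcl : IsClosed ((fun z : Plane => ε⁻¹ • (z - (1 - ε) • x)) ⁻¹' Metric.closedBall c (r / 2)) :=
    Metric.isClosed_closedBall.preimage (by fun_prop)
  refine (closure_minimal (fun z hz => ?_) hcl).trans fun z hz => ?_
  · rw [Function.mem_support, kernel_sub] at hz
    exact hb.support_subset (right_ne_zero_of_mul hz)
  · have := h.mem_of_closure (subset_closure hx) (h.closedBall_half_subset hz) hε hε1
    convert this using 1
    rw [smul_sub, smul_smul, mul_inv_cancel₀ hε.ne']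
    module

/-- The derivative falls on the kernel and is moved to f by the definition of the weak derivative.
The factor 1 - ε is the chain rule for x ↦ (1 - ε)x. -/
theorem partialDeriv_smoothing {f g : Plane → ℝ} (hf : MemLp f 2 (volume.restrict P)) {i : Fin 2}
    (hg : IsWeakPartial P i f g) {ε : ℝ} (hε : 0 < ε) (hε1 : ε ≤ 1) {x : Plane} (hx : x ∈ P) :
    partialDeriv i (smoothing P b ε f) x = (1 - ε) * smoothing P b ε g x := by
  have hk := hb.contDiff_kernel ε
  have hkc := hb.hasCompactSupport_kernel hε.ne'
  set k := kernel b ε with hkdef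
  set x₀ := (1 - ε) • x with hx₀
  have e : smoothing P b ε f = fun x =>
      ((P.indicator f) ⋆[ContinuousLinearMap.mul ℝ ℝ, volume] k) ((1 - ε) • x) :=
    funext fun x => smoothing_eq_convolution h.isOpen.measurableSet b ε f x
  have hd := hkc.hasFDerivAt_convolution_right (ContinuousLinearMap.mul ℝ ℝ)
    (h.locallyIntegrable_indicator hf) (hk.of_le (by simp)) x₀
  have hs : HasFDerivAt (fun x : Plane => (1 - ε) • x)
      ((1 - ε) • ContinuousLinearMap.id ℝ Plane) x := (hasFDerivAt_id x).const_smul (1 - ε)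
  have hcomp := hd.comp x hs
  have hφ : ContDiff ℝ ∞ fun z => k (x₀ - z) := hk.comp (contDiff_const.sub contDiff_id)
  have hφc : HasCompactSupport fun z => k (x₀ - z) :=
    hkc.comp_homeomorph (Homeomorph.subLeft x₀)
  have hpd : ∀ z, partialDeriv i (fun z => k (x₀ - z)) z =
      -(fderiv ℝ k (x₀ - z) (EuclideanSpace.single i 1)) := by
    intro z
    have h1 : HasFDerivAt (fun z => x₀ - z) (-ContinuousLinearMap.id ℝ Plane) z :=
      (hasFDerivAt_id z).const_sub x₀
    have h2 := ((hk.differentiable (by simp)) (x₀ - z)).hasFDerivAt.comp z h1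
    rw [partialDeriv, show (fun z => k (x₀ - z)) = k ∘ (fun z => x₀ - z) from rfl, h2.fderiv]
    simp
  have hw := hg.2 _ hφ hφc (h.tsupport_kernel_subset hb hx hε hε1)
  have hexists : ConvolutionExistsAt (P.indicator f) (fderiv ℝ k) x₀
      ((ContinuousLinearMap.mul ℝ ℝ).precompR Plane) volume :=
    (hkc.fderiv (𝕜 := ℝ)).convolutionExists_right _ (h.locallyIntegrable_indicator hf)
      (hk.continuous_fderiv (by simp)) x₀
  rw [partialDeriv, e]
  have hfd : fderiv ℝ (fun x => ((P.indicator f) ⋆[ContinuousLinearMap.mul ℝ ℝ, volume] k)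
      ((1 - ε) • x)) x = _ := hcomp.fderiv
  rw [hfd]
  simp only [ContinuousLinearMap.comp_apply, _root_.smul_apply,
    ContinuousLinearMap.id_apply, map_smul, smul_eq_mul]
  congr 1
  rw [convolution_def, ContinuousLinearMap.integral_apply hexists]
  simp_rw [hpd, mul_neg, integral_neg, neg_inj] at hw
  rw [smoothing, ← hkdef, ← hx₀, ← hw, ← integral_indicator h.isOpen.measurableSet]
  refine integral_congr_ae (Eventually.of_forall fun z => ?_)
  by_cases hz : z ∈ P <;> simp [hz, ContinuousLinearMap.precompR_apply]

/-- Substitute z = (1 - ε)x + εy. This form makes the operator an average and is used for the L²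
bound and for convergence. -/
theorem smoothing_eq_setIntegral (f : Plane → ℝ) {ε : ℝ} (hε : 0 < ε) (hε1 : ε ≤ 1) {x : Plane}
    (hx : x ∈ P) : smoothing P b ε f x =
      ∫ y in Metric.ball c r, b y * f (x + ε • (y - x)) := by
  have e1 : smoothing P b ε f x = ∫ z, (ε ^ 2)⁻¹ * (P.indicator f ((1 - ε) • x + z) *
      b (ε⁻¹ • z)) := by
    rw [smoothing, ← integral_indicator h.isOpen.measurableSet,
      ← integral_add_left_eq_self _ ((1 - ε) • x)]
    refine integral_congr_ae (Eventually.of_forall fun z => ?_)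
    by_cases hz : (1 - ε) • x + z ∈ P
    · simp only [indicator_of_mem hz, kernel_sub, add_sub_cancel_left]
      ring
    · simp [hz]
  have e2 := Measure.integral_comp_smul (volume : Measure Plane)
    (fun z => (ε ^ 2)⁻¹ * (P.indicator f ((1 - ε) • x + z) * b (ε⁻¹ • z))) ε
  have hε2 : |(ε ^ Module.finrank ℝ Plane)⁻¹| = (ε ^ 2)⁻¹ := by
    rw [abs_of_pos (by positivity)]
    simp
  rw [hε2, smul_eq_mul, ← e1, integral_const_mul] at e2
  have hne : (ε ^ 2)⁻¹ ≠ 0 := by positivity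
  rw [← mul_left_cancel₀ hne e2, ← integral_indicator measurableSet_ball]
  refine integral_congr_ae (Eventually.of_forall fun y => ?_)
  simp only [smul_smul, inv_mul_cancel₀ hε.ne', one_smul]
  by_cases hy : y ∈ Metric.ball c r
  · have := h.mem_of_closure (subset_closure hx) hy hε hε1
    have e3 : (1 - ε) • x + ε • y = x + ε • (y - x) := by module
    rw [e3, indicator_of_mem this, indicator_of_mem hy, mul_comm]
  · have hby : b y = 0 := by
      by_contra hne
      exact hy (h.closedBall_half_subset (hb.support_subset hne))
    simp [hby, indicator_of_notMem hy]

end StarBall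

namespace StarBall

variable {P : Set Plane} {c : Plane} {r : ℝ} (h : StarBall P c r) {b : Plane → ℝ}
  (hb : IsMollifier c r b)
include h hb

/-- After Cauchy–Schwarz in y, each map x ↦ (1 - ε)x + εy sends P into itself with Jacobian at least
1/4. The bound is therefore uniform in ε. -/
theorem lintegral_smoothing_sq_le {M : ℝ≥0∞} (hM : ∀ y, ‖b y‖ₑ ≤ M) {f : Plane → ℝ}
    (hf : Measurable f) {ε : ℝ} (hε : 0 < ε) (hε1 : ε ≤ 1 / 2) :
    ∫⁻ x in P, ‖smoothing P b ε f x‖ₑ ^ 2 ≤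
      (M * volume (Metric.ball c r)) ^ 2 * 4 * ∫⁻ x in P, ‖f x‖ₑ ^ 2 := by
  have hG : Measurable fun z => ‖f z‖ₑ ^ 2 := by fun_prop
  have key : ∀ x ∈ P, ‖smoothing P b ε f x‖ₑ ^ 2 ≤
      M ^ 2 * volume (Metric.ball c r) *
        ∫⁻ y in Metric.ball c r, ‖f (x + ε • (y - x))‖ₑ ^ 2 := by
    intro x hx
    rw [h.smoothing_eq_setIntegral hb f hε (by linarith) hx]
    have h1 : ‖∫ y in Metric.ball c r, b y * f (x + ε • (y - x))‖ₑ ≤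
        M * ∫⁻ y in Metric.ball c r, ‖f (x + ε • (y - x))‖ₑ := by
      refine (enorm_integral_le_lintegral_enorm _).trans ?_
      rw [← lintegral_const_mul _ (by fun_prop)]
      refine lintegral_mono fun y => ?_
      rw [enorm_mul]
      gcongr
      exact hM y
    refine (pow_le_pow_left' h1 2).trans ?_
    rw [mul_pow, mul_assoc]
    gcongr
    refine (sq_lintegral_le _ (by fun_prop)).trans ?_
    rw [Measure.restrict_apply_univ]
  refine (setLIntegral_mono' h.isOpen.measurableSet key).trans ?_
  rw [lintegral_const_mul _ (by
      refine Measurable.lintegral_prod_right' (f := fun q : Plane × Plane =>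
        ‖f (q.1 + ε • (q.2 - q.1))‖ₑ ^ 2) (by fun_prop)),
    lintegral_lintegral_swap (by exact (by fun_prop : Measurable _).aemeasurable)]
  calc _ ≤ M ^ 2 * volume (Metric.ball c r) *
        ∫⁻ _ in Metric.ball c r, 4 * ∫⁻ x in P, ‖f x‖ₑ ^ 2 := by
        refine mul_le_mul_right ?_ _
        exact setLIntegral_mono' measurableSet_ball fun y hy =>
          h.lintegral_set_ray_le_four hG hy hε hε1
    _ = _ := by
        rw [setLIntegral_const]
        ring

theorem eLpNorm_smoothing_le {M : ℝ≥0∞} (hM : ∀ y, ‖b y‖ₑ ≤ M) {f : Plane → ℝ}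
    (hf : MemLp f 2 (volume.restrict P)) {ε : ℝ} (hε : 0 < ε) (hε1 : ε ≤ 1 / 2) :
    eLpNorm (smoothing P b ε f) 2 (volume.restrict P) ≤
      M * volume (Metric.ball c r) * 2 * eLpNorm f 2 (volume.restrict P) := by
  -- A measurable representative is needed for the composition with affine maps; the smoothing does
  -- not see the change.
  obtain ⟨g, hg, hfg⟩ := hf.1
  rw [smoothing_congr hfg, eLpNorm_congr_ae hfg]
  refine (ENNReal.pow_le_pow_left_iff (n := 2) two_ne_zero).1 ?_
  rw [← lintegral_enorm_sq_eq, mul_pow, mul_pow, ← lintegral_enorm_sq_eq]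
  refine (h.lintegral_smoothing_sq_le hb hM hg.measurable hε hε1).trans_eq ?_
  norm_num

theorem smoothing_sub {f g : Plane → ℝ} (hf : MemLp f 2 (volume.restrict P))
    (hg : MemLp g 2 (volume.restrict P)) {ε : ℝ} (hε : ε ≠ 0) :
    smoothing P b ε (f - g) = smoothing P b ε f - smoothing P b ε g := by
  have hint : ∀ u : Plane → ℝ, MemLp u 2 (volume.restrict P) → ∀ x : Plane,
      Integrable (fun z => u z * kernel b ε ((1 - ε) • x - z)) (volume.restrict P) := by
    intro u hu x
    have hc : Continuous fun z => kernel b ε ((1 - ε) • x - z) :=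
      (hb.contDiff_kernel ε).continuous.comp (by fun_prop)
    obtain ⟨C, hC⟩ := (hb.hasCompactSupport_kernel hε).exists_bound_of_continuous
      (hb.contDiff_kernel ε).continuous
    exact (h.integrable hu).mul_bdd hc.aestronglyMeasurable
      (Eventually.of_forall fun z => hC ((1 - ε) • x - z))
  ext x
  rw [Pi.sub_apply, smoothing, smoothing, smoothing, ← integral_sub (hint f hf x) (hint g hg x)]
  simp [sub_mul]

/-- The smoothing averages values of G at distance at most ε diam P from x, so uniform continuity
suffices. As `b` is not assumed nonnegative, its L¹ norm enters. -/
theorem exists_smoothing_sub_le {G : Plane → ℝ} (hG : Continuous G) (hGc : HasCompactSupport G)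
    {δ : ℝ} (hδ : 0 < δ) : ∃ ε₀ > 0, ∀ ε, 0 < ε → ε ≤ 1 → ε < ε₀ → ∀ x ∈ P,
      ‖smoothing P b ε G x - G x‖ ≤ δ := by
  have hbi : Integrable b := hb.contDiff.continuous.integrable_of_hasCompactSupport
    hb.hasCompactSupport
  set I := ∫ y, ‖b y‖ with hI
  have hI0 : 0 ≤ I := integral_nonneg fun _ => norm_nonneg _
  obtain ⟨η, hη, hu⟩ := Metric.uniformContinuous_iff.1
    (hGc.uniformContinuous_of_continuous hG) (δ / (I + 1)) (by positivity)
  have hD := Metric.diam_nonneg (s := P)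
  refine ⟨η / (Metric.diam P + 1), by positivity, fun ε hε hε1 hεη x hx => ?_⟩
  rw [h.smoothing_eq_setIntegral hb G hε hε1 hx]
  have hb1 : ∫ y in Metric.ball c r, b y = 1 := by
    rw [← hb.integral_eq]
    refine setIntegral_eq_integral_of_forall_compl_eq_zero fun y hy => ?_
    by_contra hne
    exact hy (h.closedBall_half_subset (hb.support_subset hne))
  have hint : IntegrableOn (fun y => b y * G (x + ε • (y - x))) (Metric.ball c r) :=
    integrableOn_ball (hb.contDiff.continuous.mul (by fun_prop)) c r
  have e : G x = ∫ y in Metric.ball c r, b y * G x := by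
    rw [integral_mul_const, hb1, one_mul]
  rw [e, ← integral_sub hint (hbi.integrableOn.mul_const _)]
  have hle : ∀ y ∈ Metric.ball c r, ‖b y * G (x + ε • (y - x)) - b y * G x‖ ≤
      ‖b y‖ * (δ / (I + 1)) := by
    intro y hy
    rw [← mul_sub, norm_mul]
    gcongr
    rw [← dist_eq_norm]
    refine (hu ?_).le
    rw [dist_eq_norm, add_sub_cancel_left, norm_smul, Real.norm_of_nonneg hε.le]
    have h1 := h.norm_sub_le (subset_closure hx) (subset_closure (h.ball_subset hy))
    have h2 : ε * (Metric.diam P + 1) < η := (lt_div_iff₀ (by positivity)).1 hεη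
    nlinarith
  calc _ ≤ ∫ y in Metric.ball c r, ‖b y‖ * (δ / (I + 1)) :=
        norm_integral_le_of_norm_le (hbi.norm.integrableOn.mul_const _)
          ((ae_restrict_iff' measurableSet_ball).2 (Eventually.of_forall hle))
    _ = (∫ y in Metric.ball c r, ‖b y‖) * (δ / (I + 1)) := integral_mul_const _ _
    _ ≤ I * (δ / (I + 1)) := by
        gcongr
        exact setIntegral_le_integral hbi.norm (Eventually.of_forall fun _ => norm_nonneg _)
    _ ≤ δ := by
        rw [mul_div_assoc', div_le_iff₀ (by positivity)]
        nlinarith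

theorem tendsto_eLpNorm_smoothing_sub {f : Plane → ℝ} (hf : MemLp f 2 (volume.restrict P))
    {ε : ℕ → ℝ} (hε : ∀ n, 0 < ε n) (hε1 : ∀ n, ε n ≤ 1 / 2) (hlim : Tendsto ε atTop (𝓝 0)) :
    Tendsto (fun n => eLpNorm (smoothing P b (ε n) f - f) 2 (volume.restrict P)) atTop (𝓝 0) := by
  have hfin := h.isFiniteMeasure
  obtain ⟨M, hM⟩ := hb.hasCompactSupport.exists_bound_of_continuous hb.contDiff.continuous
  have hM' : ∀ y, ‖b y‖ₑ ≤ ENNReal.ofReal M := fun y => by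
    rw [← ofReal_norm]
    exact ENNReal.ofReal_le_ofReal (hM y)
  set A : ℝ≥0∞ := ENNReal.ofReal M * volume (Metric.ball c r) * 2 with hA
  have hAt : A ≠ ⊤ := ENNReal.mul_ne_top
    (ENNReal.mul_ne_top ENNReal.ofReal_ne_top measure_ball_lt_top.ne) (by norm_num)
  set V : ℝ≥0∞ := volume.restrict P univ ^ (2 : ℝ≥0∞).toReal⁻¹ with hV
  have hVt : V ≠ ⊤ := ENNReal.rpow_ne_top_of_nonneg (by norm_num) (MeasureTheory.measure_ne_top _ _)
  set K : ℝ≥0∞ := A + V + 1 with hK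
  have hKt : K ≠ ⊤ := by simp [hK, hAt, hVt]
  have main : ∀ δ : ℝ, 0 < δ → ∀ᶠ n in atTop,
      eLpNorm (smoothing P b (ε n) f - f) 2 (volume.restrict P) ≤ K * ENNReal.ofReal δ := by
    intro δ hδ
    obtain ⟨G, hGc, hGle, hG, hGm⟩ := hf.exists_hasCompactSupport_eLpNorm_sub_le (by norm_num)
      (ε := ENNReal.ofReal δ) (by simpa using hδ)
    obtain ⟨ε₀, hε₀, hunif⟩ := h.exists_smoothing_sub_le hb hG hGc hδ
    filter_upwards [hlim.eventually (gt_mem_nhds hε₀)] with n hn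
    -- Density argument: the outer terms are small since G is L²-close to f and smoothing is
    -- uniformly bounded; the middle one is small by uniform continuity of G.
    have e : smoothing P b (ε n) f - f = (smoothing P b (ε n) (f - G) +
        (smoothing P b (ε n) G - G)) + (G - f) := by
      rw [h.smoothing_sub hb hf hGm (hε n).ne']
      ring
    have hm : ∀ u : Plane → ℝ, MemLp u 2 (volume.restrict P) →
        AEStronglyMeasurable (smoothing P b (ε n) u) (volume.restrict P) := fun u hu =>
      (h.contDiff_smoothing hb hu (hε n).ne').continuous.aestronglyMeasurable
    have t1 : eLpNorm (smoothing P b (ε n) (f - G)) 2 (volume.restrict P) ≤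
        A * ENNReal.ofReal δ :=
      (h.eLpNorm_smoothing_le hb hM' (hf.sub hGm) (hε n) (hε1 n)).trans (by gcongr)
    have t2 : eLpNorm (smoothing P b (ε n) G - G) 2 (volume.restrict P) ≤
        V * ENNReal.ofReal δ := by
      refine eLpNorm_le_of_ae_bound ?_
      exact (ae_restrict_iff' h.isOpen.measurableSet).2 (Eventually.of_forall
        (hunif (ε n) (hε n) (by linarith [hε1 n]) hn))
    have t3 : eLpNorm (G - f) 2 (volume.restrict P) ≤ ENNReal.ofReal δ := by
      rw [eLpNorm_sub_comm]
      exact hGle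
    rw [e]
    refine (eLpNorm_add_le (((hm _ (hf.sub hGm)).add ((hm G hGm).sub hGm.1)))
      (hGm.1.sub hf.1) (by norm_num)).trans ?_
    refine (add_le_add (eLpNorm_add_le (hm _ (hf.sub hGm)) ((hm G hGm).sub hGm.1)
      (by norm_num)) le_rfl).trans ?_
    rw [hK, add_mul, add_mul, one_mul]
    gcongr
  rw [ENNReal.tendsto_nhds_zero]
  intro δ hδ
  rcases eq_or_ne δ ⊤ with rfl | hδt
  · exact Eventually.of_forall fun _ => le_top
  have hK0 : K ≠ 0 := by simp [hK]
  have hdiv : δ / K ≠ ⊤ := ENNReal.div_ne_top hδt hK0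
  have hpos : 0 < (δ / K).toReal := ENNReal.toReal_pos (ENNReal.div_pos hδ.ne' hKt).ne' hdiv
  filter_upwards [main _ hpos] with n hn
  rw [ENNReal.ofReal_toReal hdiv, ENNReal.mul_div_cancel hK0 hKt] at hn
  exact hn

end StarBall

/-! ### Density of smooth functions -/

theorem isWeakPartial_weakPartial {P : Set Plane} {i : Fin 2} {f : Plane → ℝ}
    (h : ∃ g, IsWeakPartial P i f g) : IsWeakPartial P i f (weakPartial P i f) := by
  rw [weakPartial, dif_pos h]
  exact h.choose_spec

theorem tendsto_eLpNorm_mul_sub {μ : Measure Plane} {u : ℕ → Plane → ℝ} {g : Plane → ℝ}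
    (hu : ∀ n, AEStronglyMeasurable (u n) μ) (hg : MemLp g 2 μ) {a : ℕ → ℝ}
    (ha : Tendsto a atTop (𝓝 1)) (h : Tendsto (fun n => eLpNorm (u n - g) 2 μ) atTop (𝓝 0)) :
    Tendsto (fun n => eLpNorm (a n • u n - g) 2 μ) atTop (𝓝 0) := by
  have h1 : Tendsto (fun n => ‖a n‖ₑ * eLpNorm (u n - g) 2 μ + ‖a n - 1‖ₑ * eLpNorm g 2 μ)
      atTop (𝓝 0) := by
    have t1 : Tendsto (fun n => ‖a n‖ₑ) atTop (𝓝 ‖(1 : ℝ)‖ₑ) := ha.enorm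
    have t2 : Tendsto (fun n => ‖a n - 1‖ₑ) atTop (𝓝 0) := by
      have := (ha.sub_const 1).enorm
      simpa using this
    have t3 := ENNReal.Tendsto.mul t1 (Or.inr ENNReal.zero_ne_top) h
      (Or.inr (by simp))
    have t4 := ENNReal.Tendsto.mul_const (b := eLpNorm g 2 μ) t2 (Or.inr hg.eLpNorm_ne_top)
    simpa using t3.add t4
  refine tendsto_of_tendsto_of_tendsto_of_le_of_le tendsto_const_nhds h1 (fun _ => zero_le)
    fun n => ?_
  have e : a n • u n - g = a n • (u n - g) + (a n - 1) • g := by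
    rw [smul_sub, sub_smul, one_smul]
    abel
  rw [e]
  refine (eLpNorm_add_le (((hu n).sub hg.1).const_smul _) (hg.1.const_smul _)
    (by norm_num)).trans ?_
  rw [eLpNorm_const_smul, eLpNorm_const_smul]

namespace StarBall

variable {P : Set Plane} {c : Plane} {r : ℝ} (h : StarBall P c r)
include h

/-- Derivatives of the smoothing are smoothings of the weak derivatives, up to factors 1 - ε and (1
- ε)² that tend to 1. One sequence thus serves both orders. -/
theorem exists_smooth_approx {f : Plane → ℝ} (hf : MemH1 P f) :
    ∃ φ : ℕ → Plane → ℝ, (∀ n, ContDiff ℝ ∞ (φ n)) ∧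
      Tendsto (fun n => eLpNorm (φ n - f) 2 (volume.restrict P)) atTop (𝓝 0) ∧
      (∀ i, Tendsto (fun n => eLpNorm (partialDeriv i (φ n) - weakPartial P i f) 2
        (volume.restrict P)) atTop (𝓝 0)) ∧
      (MemH2 P f → ∀ i k, Tendsto (fun n => eLpNorm (partialDeriv k (partialDeriv i (φ n)) -
        weakPartial P k (weakPartial P i f)) 2 (volume.restrict P)) atTop (𝓝 0)) := by
  obtain ⟨b, hb⟩ := exists_isMollifier c h.pos
  set ε : ℕ → ℝ := fun n => (1 / 2) * (1 / ((n : ℝ) + 1)) with hεdef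
  have hε : ∀ n, 0 < ε n := fun n => by simp only [hεdef]; positivity
  have hε1 : ∀ n, ε n ≤ 1 / 2 := fun n => by
    have : 1 / ((n : ℝ) + 1) ≤ 1 := by
      rw [div_le_one (by positivity)]
      linarith [Nat.cast_nonneg (α := ℝ) n]
    simp only [hεdef]
    linarith
  have hlim : Tendsto ε atTop (𝓝 0) := by
    have := (tendsto_one_div_add_atTop_nhds_zero_nat (𝕜 := ℝ)).const_mul (1 / 2)
    rwa [mul_zero] at this
  have ha : Tendsto (fun n => 1 - ε n) atTop (𝓝 1) := by simpa using hlim.const_sub 1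
  have hw := fun i => isWeakPartial_weakPartial (hf.2 i)
  have hsm : ∀ {u : Plane → ℝ}, MemLp u 2 (volume.restrict P) → ∀ n,
      ContDiff ℝ ∞ (smoothing P b (ε n) u) := fun hu n => h.contDiff_smoothing hb hu (hε n).ne'
  have hd1 : ∀ {u v : Plane → ℝ} {i : Fin 2}, MemLp u 2 (volume.restrict P) →
      IsWeakPartial P i u v → ∀ n, ∀ x ∈ P,
      partialDeriv i (smoothing P b (ε n) u) x = (1 - ε n) * smoothing P b (ε n) v x :=
    fun hu hv n x hx => h.partialDeriv_smoothing hb hu hv (hε n) (by linarith [hε1 n]) hx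
  refine ⟨fun n => smoothing P b (ε n) f, hsm hf.1,
    h.tendsto_eLpNorm_smoothing_sub hb hf.1 hε hε1 hlim, fun i => ?_, fun hf2 i k => ?_⟩
  · have t := tendsto_eLpNorm_mul_sub (fun n => (hsm (hw i).1 n).continuous.aestronglyMeasurable)
      (hw i).1 ha (h.tendsto_eLpNorm_smoothing_sub hb (hw i).1 hε hε1 hlim)
    refine t.congr fun n => eLpNorm_congr_ae ?_
    filter_upwards [ae_restrict_mem h.isOpen.measurableSet] with x hx
    simp [hd1 hf.1 (hw i) n x hx]
  · have hw2 := isWeakPartial_weakPartial ((hf2.2 i).2 k)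
    have ha2 : Tendsto (fun n => (1 - ε n) * (1 - ε n)) atTop (𝓝 1) := by simpa using ha.mul ha
    have t := tendsto_eLpNorm_mul_sub (fun n => (hsm hw2.1 n).continuous.aestronglyMeasurable)
      hw2.1 ha2 (h.tendsto_eLpNorm_smoothing_sub hb hw2.1 hε hε1 hlim)
    refine t.congr fun n => eLpNorm_congr_ae ?_
    filter_upwards [ae_restrict_mem h.isOpen.measurableSet] with x hx
    -- The first-derivative formula holds only on P; openness makes it valid near x, so it may be
    -- differentiated again.
    have hev : partialDeriv i (smoothing P b (ε n) f) =ᶠ[𝓝 x]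
        fun x => (1 - ε n) * smoothing P b (ε n) (weakPartial P i f) x := by
      filter_upwards [h.isOpen.mem_nhds hx] with z hz using hd1 hf.1 (hw i) n z hz
    have e : partialDeriv k (partialDeriv i (smoothing P b (ε n) f)) x =
        (1 - ε n) * ((1 - ε n) * smoothing P b (ε n) (weakPartial P k (weakPartial P i f)) x) := by
      rw [partialDeriv, hev.fderiv_eq, fderiv_const_mul
        ((hsm (hw i).1 n).differentiable (by simp) x)]
      rw [_root_.smul_apply, smul_eq_mul]
      congr 1
      exact hd1 (hw i).1 hw2 n x hx
    simp [e, mul_assoc]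

end StarBall

/-! ### Existence of traces and continuous representatives -/

theorem partialDeriv_sub {φ ψ : Plane → ℝ} (hφ : ContDiff ℝ ∞ φ) (hψ : ContDiff ℝ ∞ ψ)
    (i : Fin 2) : partialDeriv i (φ - ψ) = partialDeriv i φ - partialDeriv i ψ := by
  ext x
  simp only [partialDeriv, Pi.sub_apply]
  rw [fderiv_sub (hφ.differentiable (by simp) x) (hψ.differentiable (by simp) x)]
  rfl

theorem eLpNorm_sub_le_add {μ : Measure Plane} {u v f : Plane → ℝ}
    (hu : AEStronglyMeasurable u μ) (hv : AEStronglyMeasurable v μ)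
    (hf : AEStronglyMeasurable f μ) :
    eLpNorm (u - v) 2 μ ≤ eLpNorm (u - f) 2 μ + eLpNorm (v - f) 2 μ := by
  rw [eLpNorm_sub_comm v f, ← sub_add_sub_cancel u f v]
  exact eLpNorm_add_le (hu.sub hf) (hf.sub hv) (by norm_num)

theorem tendsto_prod_sq_add {e : ℕ → ℝ≥0∞} (he : Tendsto e atTop (𝓝 0)) :
    Tendsto (fun q : ℕ × ℕ => (e q.1 + e q.2) ^ 2) atTop (𝓝 0) := by
  rw [← prod_atTop_atTop_eq]
  have := ENNReal.Tendsto.pow (n := 2) ((he.comp tendsto_fst).add (he.comp tendsto_snd))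
  simpa using this

namespace StarBall

variable {P : Set Plane} {c : Plane} {ρ : ℝ} (h : StarBall P c (ρ * Metric.diam P))
include h

theorem enorm_average_sq_le {ψ : Plane → ℝ} (hψ : Continuous ψ) :
    ‖⨍ y in Metric.ball c (ρ * Metric.diam P / 2), ψ y‖ₑ ^ 2 ≤
      (volume (Metric.ball c (ρ * Metric.diam P / 2)))⁻¹ *
        eLpNorm ψ 2 (volume.restrict P) ^ 2 := by
  have h1 := h.measure_mul_enorm_average_sq_le hψ
  rw [lintegral_enorm_sq_eq] at h1
  rw [← ENNReal.div_eq_inv_mul, ENNReal.le_div_iff_mul_le (Or.inl h.measure_half_ne_zero)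
    (Or.inl measure_ball_lt_top.ne), mul_comm]
  exact h1

/-- Split ψ into its average and the deviation from it on each edge. The constant may depend on P,
since it only serves to show that traces converge. -/
theorem exists_trace_bound (hρ : 0 < ρ) (hd : 0 < Metric.diam P) {N : ℕ} {a b : Fin N → Plane}
    (hfr : frontier P = ⋃ j, segment ℝ (a j) (b j))
    (hl : ∀ j, ρ * Metric.diam P ≤ ‖b j - a j‖) :
    ∃ A : ℝ≥0∞, A ≠ ⊤ ∧ ∀ ψ : Plane → ℝ, ContDiff ℝ ∞ ψ →
      eLpNorm ψ 2 ((Measure.hausdorffMeasure 1).restrict (frontier P)) ^ 2 ≤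
        A * (eLpNorm ψ 2 (volume.restrict P) ^ 2 +
          ∑ i, eLpNorm (partialDeriv i ψ) 2 (volume.restrict P) ^ 2) := by
  obtain ⟨K, hK, hmain⟩ := exists_const_sub_average hρ
  set B := (volume (Metric.ball c (ρ * Metric.diam P / 2)))⁻¹ with hB
  have hBt : B ≠ ⊤ := ENNReal.inv_ne_top.2 h.measure_half_ne_zero
  refine ⟨∑ j, ENNReal.ofReal ‖b j - a j‖ * (2 * ENNReal.ofReal K + 2 * B),
    ENNReal.sum_ne_top.2 fun j _ => ENNReal.mul_ne_top ENNReal.ofReal_ne_top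
      (ENNReal.add_ne_top.2 ⟨ENNReal.mul_ne_top (by norm_num) ENNReal.ofReal_ne_top,
        ENNReal.mul_ne_top (by norm_num) hBt⟩), fun ψ hψ => ?_⟩
  have hc := hψ.continuous
  have hm := hc.measurable
  rw [← lintegral_enorm_sq_eq, hfr, Finset.sum_mul]
  refine (lintegral_iUnion_le_sum _ _ _).trans (Finset.sum_le_sum fun j _ => ?_)
  rw [lintegral_segment (by fun_prop), mul_assoc]
  gcongr
  have hj : segment ℝ (a j) (b j) ⊆ frontier P := by
    rw [hfr]
    exact subset_iUnion (fun j => segment ℝ (a j) (b j)) j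
  have h1 := (hmain P c hd h ψ hψ).2.1 _ _ hj (hl j)
  have h2 := h.enorm_average_sq_le hc
  rw [lintegral_gradSq_eq P hψ] at h1
  rw [← hB] at h2
  set m := ⨍ y in Metric.ball c (ρ * Metric.diam P / 2), ψ y
  set X := eLpNorm ψ 2 (volume.restrict P) ^ 2
  set Y := ∑ i, eLpNorm (partialDeriv i ψ) 2 (volume.restrict P) ^ 2
  calc ∫⁻ s in Ioo (0 : ℝ) 1, ‖ψ (a j + s • (b j - a j))‖ₑ ^ 2
      ≤ ∫⁻ s in Ioo (0 : ℝ) 1, (2 * ‖ψ (a j + s • (b j - a j)) - m‖ₑ ^ 2 + 2 * ‖m‖ₑ ^ 2) := by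
        refine lintegral_mono fun s => ?_
        conv_lhs => rw [← sub_add_cancel (ψ (a j + s • (b j - a j))) m]
        exact enorm_add_sq_le _ _
    _ = 2 * (∫⁻ s in Ioo (0 : ℝ) 1, ‖ψ (a j + s • (b j - a j)) - m‖ₑ ^ 2) + 2 * ‖m‖ₑ ^ 2 := by
        rw [lintegral_add_right _ measurable_const,
          lintegral_const_mul _ (Continuous.measurable (by fun_prop))]
        simp
    _ ≤ 2 * (ENNReal.ofReal K * Y) + 2 * (B * X) := by gcongr
    _ ≤ 2 * (ENNReal.ofReal K * (X + Y)) + 2 * (B * (X + Y)) := by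
        gcongr
        · exact le_add_self
        · exact le_self_add
    _ = _ := by ring

theorem exists_sup_bound (hρ : 0 < ρ) (hd : 0 < Metric.diam P) :
    ∃ A : ℝ≥0∞, A ≠ ⊤ ∧ ∀ ψ : Plane → ℝ, ContDiff ℝ ∞ ψ → ∀ x ∈ closure P,
      ‖ψ x‖ₑ ^ 2 ≤ A * (eLpNorm ψ 2 (volume.restrict P) ^ 2 +
          ∑ i, eLpNorm (partialDeriv i ψ) 2 (volume.restrict P) ^ 2 +
          ∑ i, ∑ k, eLpNorm (partialDeriv k (partialDeriv i ψ)) 2 (volume.restrict P) ^ 2) := by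
  obtain ⟨K, hK, hmain⟩ := exists_const_sub_average hρ
  set B := (volume (Metric.ball c (ρ * Metric.diam P / 2)))⁻¹ with hB
  have hBt : B ≠ ⊤ := ENNReal.inv_ne_top.2 h.measure_half_ne_zero
  set d := ENNReal.ofReal (Metric.diam P) with hdd
  refine ⟨2 * ENNReal.ofReal K + 2 * ENNReal.ofReal K * d ^ 2 + 2 * B, by
    have h1 : d ≠ ⊤ := ENNReal.ofReal_ne_top
    have h2 : ENNReal.ofReal K ≠ ⊤ := ENNReal.ofReal_ne_top
    finiteness, fun ψ hψ x hx => ?_⟩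
  have h1 := (hmain P c hd h ψ hψ).2.2 x hx
  have h2 := h.enorm_average_sq_le hψ.continuous
  rw [lintegral_gradSq_eq P hψ, lintegral_hessSq_eq P hψ] at h1
  rw [← hB] at h2
  set m := ⨍ y in Metric.ball c (ρ * Metric.diam P / 2), ψ y
  set X := eLpNorm ψ 2 (volume.restrict P) ^ 2
  set Y := ∑ i, eLpNorm (partialDeriv i ψ) 2 (volume.restrict P) ^ 2
  set Z := ∑ i, ∑ k, eLpNorm (partialDeriv k (partialDeriv i ψ)) 2 (volume.restrict P) ^ 2
  calc ‖ψ x‖ₑ ^ 2 ≤ 2 * ‖ψ x - m‖ₑ ^ 2 + 2 * ‖m‖ₑ ^ 2 := by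
        conv_lhs => rw [← sub_add_cancel (ψ x) m]
        exact enorm_add_sq_le _ _
    _ ≤ 2 * (ENNReal.ofReal K * (Y + d ^ 2 * Z)) + 2 * (B * X) := by gcongr
    _ ≤ 2 * (ENNReal.ofReal K * ((X + Y + Z) + d ^ 2 * (X + Y + Z))) + 2 * (B * (X + Y + Z)) := by
        have hX : X ≤ X + Y + Z := le_self_add.trans le_self_add
        have hY : Y ≤ X + Y + Z := le_add_self.trans le_self_add
        have hZ : Z ≤ X + Y + Z := le_add_self
        gcongr
    _ = _ := by ring

end StarBall

namespace StarBall

variable {P : Set Plane} {c : Plane} {ρ : ℝ} (h : StarBall P c (ρ * Metric.diam P))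
include h

/-- The trace inequality for differences makes the approximants Cauchy in L²(∂P), which is complete.
-/
theorem exists_isTrace (hρ : 0 < ρ) (hd : 0 < Metric.diam P) {N : ℕ} {a b : Fin N → Plane}
    (hfr : frontier P = ⋃ j, segment ℝ (a j) (b j))
    (hl : ∀ j, ρ * Metric.diam P ≤ ‖b j - a j‖) {f : Plane → ℝ} (hf : MemH1 P f) :
    ∃ g, IsTrace P f g := by
  obtain ⟨φ, hφ, h0, h1, -⟩ := h.exists_smooth_approx hf
  obtain ⟨A, hA, hbound⟩ := h.exists_trace_bound hρ hd hfr hl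
  set μ := (Measure.hausdorffMeasure 1 : Measure Plane).restrict (frontier P) with hμ
  have hfin : IsFiniteMeasure μ := by
    rw [hμ, hfr]
    exact isFiniteMeasure_hausdorffMeasure_iUnion_segment a b
  have hmem : ∀ n, MemLp (φ n) 2 μ := fun n =>
    memLp_of_continuous h.isBounded.closure ((ae_restrict_mem isClosed_frontier.measurableSet).mono
      fun x hx => frontier_subset_closure hx) (hφ n).continuous 2
  have hpd := fun n i => contDiff_partialDeriv (hφ n) i
  have hsq : Tendsto (fun q : ℕ × ℕ => eLpNorm (φ q.1 - φ q.2) 2 μ ^ 2) atTop (𝓝 0) := by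
    have hR := (tendsto_prod_sq_add h0).add (tendsto_finsetSum (Finset.univ : Finset (Fin 2))
      fun i _ => tendsto_prod_sq_add (h1 i))
    have hR' := ENNReal.Tendsto.const_mul (a := A) hR (Or.inr hA)
    simp only [Finset.sum_const_zero, add_zero, mul_zero] at hR'
    refine tendsto_of_tendsto_of_tendsto_of_le_of_le tendsto_const_nhds hR' (fun _ => zero_le)
      fun q => ?_
    have hs : ContDiff ℝ ∞ (φ q.1 - φ q.2) := (hφ q.1).sub (hφ q.2)
    refine (hbound _ hs).trans ?_
    simp only [partialDeriv_sub (hφ q.1) (hφ q.2)]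
    gcongr with i
    · exact eLpNorm_sub_le_add (hφ _).continuous.aestronglyMeasurable
        (hφ _).continuous.aestronglyMeasurable hf.1.1
    · exact eLpNorm_sub_le_add (hpd _ i).continuous.aestronglyMeasurable
        (hpd _ i).continuous.aestronglyMeasurable (isWeakPartial_weakPartial (hf.2 i)).1.1
  have hlim : Tendsto (fun q : ℕ × ℕ => eLpNorm (φ q.1 - φ q.2) 2 μ) atTop (𝓝 0) := by
    have := (ENNReal.continuous_rpow_const (y := 1 / 2)).continuousAt.tendsto.comp hsq
    rw [ENNReal.zero_rpow_of_pos (by norm_num)] at this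
    refine this.congr fun q => ?_
    rw [Function.comp_apply, ← ENNReal.rpow_natCast, ← ENNReal.rpow_mul]
    norm_num
  have hcauchy : CauchySeq fun n => (hmem n).toLp (φ n) := by
    rw [Lp.cauchySeq_Lp_iff_cauchySeq_eLpNorm]
    refine hlim.congr fun q => eLpNorm_congr_ae ?_
    exact ((hmem q.1).coeFn_toLp.sub (hmem q.2).coeFn_toLp).symm
  obtain ⟨g, hg⟩ := cauchySeq_tendsto_of_complete hcauchy
  refine ⟨g, Lp.memLp g, φ, hφ, h0, h1, ?_⟩
  have hg' := (Lp.tendsto_Lp_iff_tendsto_eLpNorm' _ _).1 hg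
  refine hg'.congr fun n => eLpNorm_congr_ae ?_
  exact (hmem n).coeFn_toLp.sub EventuallyEq.rfl

theorem tendsto_smoothH1 {f : Plane → ℝ} (hf : MemH1 P f) {φ : ℕ → Plane → ℝ}
    (hφ : ∀ n, ContDiff ℝ ∞ (φ n))
    (h1 : ∀ i, Tendsto (fun n => eLpNorm (partialDeriv i (φ n) - weakPartial P i f) 2
        (volume.restrict P)) atTop (𝓝 0)) :
    Tendsto (fun n => smoothH1 P (φ n)) atTop (𝓝 (h1Seminorm P f)) :=
  (tendsto_finsetSum _ fun i _ => (tendsto_l2Norm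
    (fun n => h.memLp (contDiff_partialDeriv (hφ n) i).continuous)
    (isWeakPartial_weakPartial (hf.2 i)).1 (h1 i)).pow 2).sqrt

theorem tendsto_smoothH2 {f : Plane → ℝ} (hf : MemH2 P f) {φ : ℕ → Plane → ℝ}
    (hφ : ∀ n, ContDiff ℝ ∞ (φ n))
    (h2 : ∀ i k, Tendsto (fun n => eLpNorm (partialDeriv k (partialDeriv i (φ n)) -
        weakPartial P k (weakPartial P i f)) 2 (volume.restrict P)) atTop (𝓝 0)) :
    Tendsto (fun n => smoothH2 P (φ n)) atTop (𝓝 (h2Seminorm P f)) :=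
  (tendsto_finsetSum _ fun i _ => tendsto_finsetSum _ fun k _ => (tendsto_l2Norm
    (fun n => h.memLp (contDiff_partialDeriv (contDiff_partialDeriv (hφ n) i) k).continuous)
    (isWeakPartial_weakPartial ((hf.2 i).2 k)).1 (h2 i k)).pow 2).sqrt

/-- The smooth approximations of an `H²` function converge on the closure to its continuous
representative. -/
theorem tendsto_continuousRep (hρ : 0 < ρ) (hd : 0 < Metric.diam P) {f : Plane → ℝ}
    (hf : MemH2 P f) {φ : ℕ → Plane → ℝ} (hφ : ∀ n, ContDiff ℝ ∞ (φ n))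
    (h0 : Tendsto (fun n => eLpNorm (φ n - f) 2 (volume.restrict P)) atTop (𝓝 0))
    (h1 : ∀ i, Tendsto (fun n => eLpNorm (partialDeriv i (φ n) - weakPartial P i f) 2
        (volume.restrict P)) atTop (𝓝 0))
    (h2 : ∀ i k, Tendsto (fun n => eLpNorm (partialDeriv k (partialDeriv i (φ n)) -
        weakPartial P k (weakPartial P i f)) 2 (volume.restrict P)) atTop (𝓝 0)) :
    continuousRep P f =ᵐ[volume.restrict P] f ∧ ∀ x ∈ closure P,
      Tendsto (fun n => φ n x) atTop (𝓝 (continuousRep P f x)) := by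
  obtain ⟨A, hA, hbound⟩ := h.exists_sup_bound hρ hd
  have hpd := fun n i => contDiff_partialDeriv (hφ n) i
  have hpd2 := fun n i k => contDiff_partialDeriv (hpd n i) k
  have hR := ((tendsto_prod_sq_add h0).add (tendsto_finsetSum (Finset.univ : Finset (Fin 2))
      fun i _ => tendsto_prod_sq_add (h1 i))).add
      (tendsto_finsetSum (Finset.univ : Finset (Fin 2)) fun i _ =>
        tendsto_finsetSum (Finset.univ : Finset (Fin 2)) fun k _ => tendsto_prod_sq_add (h2 i k))
  have hR' := ENNReal.Tendsto.const_mul (a := A) hR (Or.inr hA)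
  simp only [Finset.sum_const_zero, add_zero, mul_zero] at hR'
  obtain ⟨R, hR0, hdiff⟩ : ∃ R : ℕ × ℕ → ℝ≥0∞, Tendsto R atTop (𝓝 0) ∧
      ∀ q : ℕ × ℕ, ∀ x ∈ closure P, ‖φ q.1 x - φ q.2 x‖ₑ ^ 2 ≤ R q := by
    refine ⟨_, hR', fun q x hx => ?_⟩
    have hs : ContDiff ℝ ∞ (φ q.1 - φ q.2) := (hφ q.1).sub (hφ q.2)
    refine (hbound _ hs x hx).trans ?_
    simp only [partialDeriv_sub (hφ q.1) (hφ q.2), partialDeriv_sub (hpd q.1 _) (hpd q.2 _)]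
    refine mul_le_mul_right (add_le_add (add_le_add ?_ (Finset.sum_le_sum fun i _ => ?_))
      (Finset.sum_le_sum fun i _ => Finset.sum_le_sum fun k _ => ?_)) A
    · exact pow_le_pow_left' (eLpNorm_sub_le_add (hφ _).continuous.aestronglyMeasurable
        (hφ _).continuous.aestronglyMeasurable hf.1.1.1) 2
    · exact pow_le_pow_left' (eLpNorm_sub_le_add (hpd _ i).continuous.aestronglyMeasurable
        (hpd _ i).continuous.aestronglyMeasurable (isWeakPartial_weakPartial (hf.1.2 i)).1.1) 2
    · exact pow_le_pow_left' (eLpNorm_sub_le_add (hpd2 _ i k).continuous.aestronglyMeasurable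
        (hpd2 _ i k).continuous.aestronglyMeasurable
        (isWeakPartial_weakPartial ((hf.2 i).2 k)).1.1) 2
  have hcauchy : UniformCauchySeqOn φ atTop (closure P) := by
    rw [Metric.uniformCauchySeqOn_iff]
    intro δ hδ
    have hev := hR0.eventually (gt_mem_nhds (ENNReal.ofReal_pos.2 (pow_pos hδ 2)))
    obtain ⟨n₀, hn₀⟩ := eventually_atTop_prod_self'.1 hev
    refine ⟨n₀, fun m hm n hn x hx => ?_⟩
    have h3 := (hdiff (m, n) x hx).trans_lt (hn₀ m hm n hn)
    rw [ENNReal.ofReal_pow hδ.le, Real.enorm_eq_ofReal_abs] at h3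
    have h4 := (ENNReal.pow_lt_pow_left_iff (n := 2) two_ne_zero).1 h3
    rw [Real.dist_eq]
    exact (ENNReal.ofReal_lt_ofReal_iff hδ).1 h4
  have hlim : ∀ x ∈ closure P, ∃ y, Tendsto (fun n => φ n x) atTop (𝓝 y) := fun x hx =>
    cauchySeq_tendsto_of_complete (hcauchy.cauchySeq hx)
  choose! F hF using hlim
  have hunif := hcauchy.tendstoUniformlyOn_of_tendsto hF
  have hFc : ContinuousOn F (closure P) := hunif.continuousOn
    (Frequently.of_forall fun n => (hφ n).continuous.continuousOn)
  -- L² convergence gives an almost everywhere convergent subsequence, whose limit must be both F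
  -- and f.
  have hFf : F =ᵐ[volume.restrict P] f := by
    obtain ⟨ns, hns, hae⟩ := (tendstoInMeasure_of_tendsto_eLpNorm (by norm_num)
      (fun n => (hφ n).continuous.aestronglyMeasurable) hf.1.1.1 h0).exists_seq_tendsto_ae
    filter_upwards [hae, ae_restrict_mem h.isOpen.measurableSet] with x hx hxP
    exact tendsto_nhds_unique ((hF x (subset_closure hxP)).comp hns.tendsto_atTop) hx
  have hex : ∃ F, IsContinuousRep P f F := ⟨F, hFc, hFf⟩
  have hspec : IsContinuousRep P f (continuousRep P f) := by
    rw [continuousRep, dif_pos hex]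
    exact hex.choose_spec
  refine ⟨hspec.2, fun x hx => ?_⟩
  -- Continuous functions that agree almost everywhere on an open set agree on it, hence on its
  -- closure. So the representative picked by choice is the uniform limit F, also at the vertices.
  have heqP : EqOn (continuousRep P f) F P :=
    Measure.eqOn_open_of_ae_eq (hspec.2.trans hFf.symm) h.isOpen
      (hspec.1.mono subset_closure) (hFc.mono subset_closure)
  have heq : EqOn (continuousRep P f) F (closure P) :=
    heqP.of_subset_closure hspec.1 hFc subset_closure subset_rfl
  rw [heq hx]
  exact hF x hx

end StarBall

/-! ### Passage to the limit and conclusion -/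

theorem diam_pos_of_isOpen {P : Set Plane} (hP : IsOpen P) (hne : P.Nonempty)
    (hb : Bornology.IsBounded P) : 0 < Metric.diam P := by
  obtain ⟨x, hx⟩ := hne
  obtain ⟨δ, hδ, hball⟩ := Metric.isOpen_iff.1 hP x hx
  have hn : ‖(δ / 2) • (EuclideanSpace.single 0 1 : Plane)‖ = δ / 2 := by
    rw [norm_smul, Real.norm_of_nonneg (by positivity)]
    simp
  have hy : x + (δ / 2) • (EuclideanSpace.single 0 1 : Plane) ∈ P := hball (by
    rw [Metric.mem_ball, dist_eq_norm, add_sub_cancel_left, hn]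
    linarith)
  have := Metric.dist_le_diam_of_mem hb hy hx
  rw [dist_eq_norm, add_sub_cancel_left, hn] at this
  linarith

/-- The ball is shrunk to radius exactly ρ diam P, so that all constants are functions of ρ. -/
theorem MeshRegular.exists_starBall {ρ : ℝ} {N : ℕ} {p : Polygon Plane N} {P : Set Plane}
    (hρ : 0 < ρ) (hP : IsPolygonalDomain p P) (hM : MeshRegular ρ p P) :
    ∃ c, StarBall P c (ρ * Metric.diam P) := by
  obtain ⟨c, r, hr, hstar⟩ := hM.starShaped
  exact ⟨c, hP.isOpen, hP.isBounded, hP.isConnected.1,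
    mul_pos hρ (diam_pos_of_isOpen hP.isOpen hP.isConnected.1 hP.isBounded),
    fun y hy => hstar y (Metric.ball_subset_ball hr hy)⟩

/-- Poincaré inequalities on mesh-regular polygonal domains for functions with a vanishing convex
combination of edge integrals or of vertex values. -/
theorem exists_const_poincare {ρ : ℝ} (hρ : 0 < ρ) : ∃ C : ℝ, 0 < C ∧
    ∀ (N : ℕ) (p : Polygon Plane N) (P : Set Plane), IsPolygonalDomain p P → MeshRegular ρ p P →
    (∀ f : Plane → ℝ, MemH1 P f →
      (0 : ℝ) ∈ convexHull ℝ (range fun j : Fin N => edgeIntegral p P f j) →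
      l2Norm P f ≤ C * Metric.diam P * h1Seminorm P f) ∧
    (∀ f : Plane → ℝ, MemH2 P f →
      (0 : ℝ) ∈ convexHull ℝ (range fun j : Fin N => vertexValue p P f j) →
      l2Norm P f ≤ √(volume (Metric.ball (0 : Plane) 1)).toReal * Metric.diam P *
        (C * (h1Seminorm P f + Metric.diam P * h2Seminorm P f))) := by
  obtain ⟨C, hC, hmain⟩ := exists_const_smooth hρ
  refine ⟨C, hC, fun N p P hP hM => ?_⟩
  obtain ⟨c, h⟩ := hM.exists_starBall hρ hP
  have hd := diam_pos_of_isOpen hP.isOpen hP.isConnected.1 hP.isBounded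
  have hfr : frontier P = ⋃ j, segment ℝ (p j) (p (finRotate N j)) := by
    rw [hP.frontier_eq, Polygon.boundary]
    simp only [Polygon.edgeSet, affineSegment_eq_segment]
  have hsub : ∀ j, segment ℝ (p j) (p (finRotate N j)) ⊆ frontier P := fun j => by
    rw [hfr]
    exact subset_iUnion (fun j => segment ℝ (p j) (p (finRotate N j))) j
  have hl : ∀ j, ρ * Metric.diam P ≤ ‖p (finRotate N j) - p j‖ := fun j => by
    rw [← dist_eq_norm, dist_comm]
    exact hM.edge_length j
  refine ⟨fun f hf h0 => ?_, fun f hf h0 => ?_⟩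
  · obtain ⟨w, hw, hw1, hsum⟩ := exists_weights_of_mem_convexHull h0
    have hex := h.exists_isTrace hρ hd hfr hl hf
    have htr : IsTrace P f (trace P f) := by
      rw [trace, dif_pos hex]
      exact hex.choose_spec
    -- The approximants are those attached to the chosen trace, so uniqueness of the trace is not
    -- needed.
    obtain ⟨hg, φ, hφ, hφ0, hφ1, hφt⟩ := htr
    have hfin : IsFiniteMeasure ((Measure.hausdorffMeasure 1 : Measure Plane).restrict
        (frontier P)) := by
      rw [hfr]
      exact isFiniteMeasure_hausdorffMeasure_iUnion_segment _ _
    have hmem : ∀ n, MemLp (φ n) 2 ((Measure.hausdorffMeasure 1).restrict (frontier P)) :=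
      fun n => memLp_of_continuous h.isBounded.closure
        ((ae_restrict_mem isClosed_frontier.measurableSet).mono
          fun x hx => frontier_subset_closure hx) (hφ n).continuous 2
    have hedge : ∀ j, Tendsto (fun n => ‖p (finRotate N j) - p j‖ *
        ∫ s in Ioo (0 : ℝ) 1, φ n (p j + s • (p (finRotate N j) - p j))) atTop
        (𝓝 (edgeIntegral p P f j)) := by
      intro j
      have := isFiniteMeasure_hausdorffMeasure_segment (p j) (p (finRotate N j))
      have ht := tendsto_setIntegral_of_tendsto_eLpNorm (hsub j) hmem hg hφt
      simp only [integral_segment (hφ _).continuous] at ht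
      rw [edgeIntegral, Polygon.edgeSet, affineSegment_eq_segment]
      exact ht
    have hS := (tendsto_finsetSum Finset.univ fun j _ => (hedge j).const_mul (w j)).abs
    rw [hsum, abs_zero] at hS
    have hlhs := tendsto_l2Norm (fun n => h.memLp (hφ n).continuous) hf.1 hφ0
    have hrhs := (((h.tendsto_smoothH1 hf hφ hφ1).const_mul (Metric.diam P)).add hS).const_mul C
    rw [add_zero, ← mul_assoc] at hrhs
    exact le_of_tendsto_of_tendsto' hlhs hrhs fun n =>
      (hmain P c hd h (φ n) (hφ n) N _ _ w hw hw1 hsub hl).1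
  · obtain ⟨w, hw, hw1, hsum⟩ := exists_weights_of_mem_convexHull h0
    obtain ⟨φ, hφ, hφ0, hφ1, hφ2⟩ := h.exists_smooth_approx hf.1
    obtain ⟨hrep, hpt⟩ := h.tendsto_continuousRep hρ hd hf hφ hφ0 hφ1 (hφ2 hf)
    have hS := (tendsto_finsetSum Finset.univ fun j _ => (hpt (p j)
      (frontier_subset_closure (hsub j (left_mem_segment ℝ _ _)))).const_mul (w j)).abs
    have hsum' : ∑ j, w j * continuousRep P f (p j) = 0 := hsum
    rw [hsum', abs_zero] at hS
    have hrhs := (((h.tendsto_smoothH1 hf.1 hφ hφ1).add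
      ((h.tendsto_smoothH2 hf hφ (hφ2 hf)).const_mul (Metric.diam P))).const_mul C).add hS
    rw [add_zero] at hrhs
    have hle : ∀ x ∈ P, |continuousRep P f x| ≤
        C * (h1Seminorm P f + Metric.diam P * h2Seminorm P f) := fun x hx =>
      le_of_tendsto_of_tendsto' (hpt x (subset_closure hx)).abs hrhs fun n =>
        (hmain P c hd h (φ n) (hφ n) N _ _ w hw hw1 hsub hl).2 x (subset_closure hx)
    have e : l2Norm P f = l2Norm P (continuousRep P f) := by
      rw [l2Norm, l2Norm, eLpNorm_congr_ae hrep]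
    rw [e]
    refine h.l2Norm_le_of_abs_le ?_ hle
    have h1 : 0 ≤ h1Seminorm P f := Real.sqrt_nonneg _
    have h2 : 0 ≤ h2Seminorm P f := Real.sqrt_nonneg _
    positivity

theorem h2Seminorm_eq (P : Set Plane) (f : Plane → ℝ) :
    h2Seminorm P f = √(∑ i, h1Seminorm P (weakPartial P i f) ^ 2) := by
  unfold h2Seminorm h1Seminorm
  congr 1
  exact Finset.sum_congr rfl fun i _ =>
    (Real.sq_sqrt (Finset.sum_nonneg fun k _ => sq_nonneg _)).symm

theorem h1Seminorm_le_of_forall_le {P : Set Plane} {f : Plane → ℝ} {M : ℝ} (hM : 0 ≤ M)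
    (h : ∀ i, l2Norm P (weakPartial P i f) ≤ M * h1Seminorm P (weakPartial P i f)) :
    h1Seminorm P f ≤ M * h2Seminorm P f := by
  rw [h2Seminorm_eq, h1Seminorm, ← Real.sqrt_sq hM, ← Real.sqrt_mul (sq_nonneg M),
    Finset.mul_sum]
  refine Real.sqrt_le_sqrt (Finset.sum_le_sum fun i _ => ?_)
  rw [← mul_pow]
  exact pow_le_pow_left₀ (l2Norm_nonneg _ _) (h i) 2

end PolygonPF

theorem theorem2p2 (ρ : ℝ) (hρ : 0 < ρ) :
    ∃ C : ℝ, 0 < C ∧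
      ∀ (N : ℕ) (p : Polygon PolygonPF.Plane N) (P : Set PolygonPF.Plane),
        PolygonPF.IsPolygonalDomain p P → PolygonPF.MeshRegular ρ p P →
        (∀ f : PolygonPF.Plane → ℝ, PolygonPF.MemH1 P f →
          (0 : ℝ) ∈ convexHull ℝ (Set.range fun j : Fin N => PolygonPF.edgeIntegral p P f j) →
          PolygonPF.l2Norm P f ≤ C * Metric.diam P * PolygonPF.h1Seminorm P f) ∧
        (∀ f : PolygonPF.Plane → ℝ, PolygonPF.MemH2 P f →
          (0 : ℝ) ∈ convexHull ℝ (Set.range fun j : Fin N => PolygonPF.vertexValue p P f j) →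
          (∀ i : Fin 2, (0 : ℝ) ∈ convexHull ℝ (Set.range fun j : Fin N =>
            PolygonPF.edgeIntegral p P (PolygonPF.weakPartial P i f) j)) →
          Metric.diam P ^ (-2 : ℤ) * PolygonPF.l2Norm P f
              + Metric.diam P ^ (-1 : ℤ) * PolygonPF.h1Seminorm P f
            ≤ C * PolygonPF.h2Seminorm P f) := by
  obtain ⟨C, hC, hmain⟩ := PolygonPF.exists_const_poincare hρ
  set β := √(volume (Metric.ball (0 : PolygonPF.Plane) 1)).toReal with hβ
  have hβ0 : 0 ≤ β := Real.sqrt_nonneg _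
  -- In (b) the summand C bounds the gradient term; inserting |f|₁ ≤ C h |f|₂ into the uniform bound
  -- gives β C (C + 1) for the L² term.
  refine ⟨C + β * (C * (C + 1)), by positivity, fun N p P hP hM => ?_⟩
  have hd := PolygonPF.diam_pos_of_isOpen hP.isOpen hP.isConnected.1 hP.isBounded
  obtain ⟨ha, hb⟩ := hmain N p P hP hM
  refine ⟨fun f hf h0 => (ha f hf h0).trans ?_, fun f hf h0 h1 => ?_⟩
  · have hs : 0 ≤ PolygonPF.h1Seminorm P f := Real.sqrt_nonneg _
    gcongr
    exact le_add_of_nonneg_right (by positivity)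
  · have hs : 0 ≤ PolygonPF.h2Seminorm P f := Real.sqrt_nonneg _
    have e1 := PolygonPF.h1Seminorm_le_of_forall_le (P := P) (f := f)
      (M := C * Metric.diam P) (by positivity) fun i => ha _ (hf.2 i) (h1 i)
    have e0 := hb f hf h0
    set d := Metric.diam P
    set s := PolygonPF.h2Seminorm P f
    have e2 : PolygonPF.l2Norm P f ≤ β * d * (C * (C * d * s + d * s)) := e0.trans (by gcongr)
    rw [zpow_neg, zpow_neg, zpow_one]
    calc (d ^ (2 : ℤ))⁻¹ * PolygonPF.l2Norm P f + d⁻¹ * PolygonPF.h1Seminorm P f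
        ≤ (d ^ (2 : ℤ))⁻¹ * (β * d * (C * (C * d * s + d * s))) + d⁻¹ * (C * d * s) := by gcongr
      _ = (C + β * (C * (C + 1))) * s := by
        rw [zpow_ofNat]
        field_simp
        ring
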